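/- Let $n\ge 0$, let $B\subseteq GL_n(\mathbb{C})$ be the group of invertible upper triangular matrices, $\mathfrak{b}$ the space of upper triangular $n\times n$ matrices, and $\mathfrak{b}^*=\mathfrak{gl}_n/\mathfrak{u}^+$, where $\mathfrak{u}^+$ is the space of strictly upper triangular matrices. The group $B$ acts on $T^*(\mathfrak{b}\times\mathbb{C}^n)=\mathfrak{b}\times\mathfrak{b}^*\times\mathbb{C}^n\times(\mathbb{C}^n)^*$ by $b.(r,s,i,j)=(brb^{-1},bsb^{-1},bi,jb^{-1})$, with moment map $\mu(r,s,i,j)=[r,s]+ij\in\mathfrak{b}^*$. Let $$\mu^{-1}(0)^{rss}=\{(r,s,i,j)\in\mu^{-1}(0): r \text{ has pairwise distinct eigenvalues}\},$$ with coordinate ring $\mathbb{C}[\mu^{-1}(0)^{rss}]$ the quotient of $\mathbb{C}[r_{\alpha\beta},s_{\beta\alpha},x_k,y_k : 1\le \alpha\le\beta\le n,\ 1\le k\le n]\,[(r_{\nu\nu}-r_{\gamma\gamma})^{-1}: \nu\ne\gamma]$ by the ideal generated by the entries $([r,s]+ij)_{\iota\gamma}$, $\iota\ge\gamma$, where $x_k$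 and $y_k$ are the entries of $i$ and $j$. Let $\mu^{-1}(0)^{rss}/\!\!/B=\operatorname{Spec}\mathbb{C}[\mu^{-1}(0)^{rss}]^B$ be the affine quotient. For $1\le\iota\le n$ put $$s'_{\iota\iota}=\Big[\operatorname{tr}\prod_{k\ne\iota}(r-r_{kk}I)\Big]^{-1}\operatorname{tr}\Big(\prod_{k\neq\iota}(r-r_{kk}I)\, s\Big),$$ let $\Delta_n=\{(x_{11},\dots,x_{nn},y_{11},\dots,y_{nn}): x_{\iota\iota}=x_{\gamma\gamma}\text{ for some }\iota\ne\gamma\}\subseteq\mathbb{C}^{2n}$, and let $$P:\mu^{-1}(0)^{rss}\to\mathbb{C}^{2n}\setminus\Delta_n,\qquad (r,s,i,j)\mapsto(r_{11},\dots,r_{nn},s'_{11},\dots,s'_{nn}).$$ Then, in the Zariski topology: (1) For $z,w\in\mu^{-1}(0)^{rss}$, $P(z)=P(w)$ if and only if $\overline{B.z}\cap\overline{B.w}\neq\varnothing$ (closures in $\mu^{-1}(0)^{rss}$), and $P$ descends to a bijective homeomorphism $\overline{B.z}\mapsto P(z)$ onto $\mathbb{C}^{2n}\setminus\Delta_n$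 from the quotient of $\mu^{-1}(0)^{rss}$ that identifies points whose orbit closures meet. (2) The comorphism of $P$ is an isomorphism of $\mathbb{C}$-algebras $$\mathbb{C}[r_{11},\dots,r_{nn},s'_{11},\dots,s'_{nn}][(r_{\nu\nu}-r_{\gamma\gamma})^{-1}:\nu\ne\gamma]\;\cong\;\mathbb{C}[\mu^{-1}(0)^{rss}]^B$$ (on the left the $r_{\iota\iota}$ and $s'_{\iota\iota}$ are independent variables, and they are sent to the functions of the same name). (3) $P$ induces an isomorphism of varieties over $\mathbb{C}$, $\mu^{-1}(0)^{rss}/\!\!/B\cong\mathbb{C}^{2n}\setminus\Delta_n$, whose composite with the quotient map $\mu^{-1}(0)^{rss}\to\mu^{-1}(0)^{rss}/\!\!/B$ is $P$. -/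

import Mathlib

open CategoryTheory AlgebraicGeometry Matrix

noncomputable section

namespace BorelMoment

/-! ### Triangular matrices and the Borel subgroup -/

/-- The Borel subgroup `B ⊆ GL_n(ℂ)` of invertible upper triangular matrices. -/
def Borel (n : ℕ) : Subgroup (GL (Fin n) ℂ) where
  carrier := {g | (g : Matrix (Fin n) (Fin n) ℂ).IsUpperTriangular}
  mul_mem' {a b} ha hb := by
    have h := Matrix.BlockTriangular.mul ha hb
    simpa [Set.mem_ofPred_eq] using h
  one_mem' := by
    simpa [Set.mem_ofPred_eq] using
      (Matrix.blockTriangular_one : (1 : Matrix (Fin n) (Fin n) ℂ).BlockTriangular id)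
  inv_mem' {a} ha := by
    let _ : Invertible (a : Matrix (Fin n) (Fin n) ℂ) := a.invertible
    have h := Matrix.blockTriangular_inv_of_blockTriangular (M := (a : Matrix (Fin n) (Fin n) ℂ)) ha
    simpa [Set.mem_ofPred_eq] using h

/-- An element of `B`, viewed as an invertible matrix over a `ℂ`-algebra `A`. -/
def Borel.toGL {n : ℕ} (A : Type*) [CommRing A] [Algebra ℂ A] : Borel n →* GL (Fin n) A :=
  (GeneralLinearGroup.map (algebraMap ℂ A)).comp (Borel n).subtype

theorem Borel.toGL_upper {n : ℕ} (A : Type*) [CommRing A] [Algebra ℂ A] (b : Borel n) :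
    (Borel.toGL A b : Matrix (Fin n) (Fin n) A).IsUpperTriangular := by
  intro i j hij
  have h : ((b : GL (Fin n) ℂ) : Matrix (Fin n) (Fin n) ℂ) i j = 0 := b.2 hij
  simp [Borel.toGL, h]

/-- The entries of a matrix on and below the main diagonal (the remaining ones are set to `0`).
As the strictly upper triangular matrices form the kernel, this is the projection
`𝔤𝔩_n → 𝔤𝔩_n / 𝔲⁺ = 𝔟*`, every class in `𝔤𝔩_n / 𝔲⁺` being represented by its unique lower
triangular element. -/
def lowerPart {n : ℕ} {A : Type*} [CommRing A] :
    Matrix (Fin n) (Fin n) A →ₗ[A] Matrix (Fin n) (Fin n) A where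
  toFun M := Matrix.of fun ι γ => if γ ≤ ι then M ι γ else 0
  map_add' M N := by ext ι γ; by_cases h : γ ≤ ι <;> simp [h]
  map_smul' c M := by ext ι γ; by_cases h : γ ≤ ι <;> simp [h]

section lowerPart

variable {n : ℕ} {A : Type*} [CommRing A]

theorem lowerPart_apply (M : Matrix (Fin n) (Fin n) A) (ι γ : Fin n) :
    lowerPart M ι γ = if γ ≤ ι then M ι γ else 0 := rfl

theorem lowerPart_eq_zero_iff (M : Matrix (Fin n) (Fin n) A) :
    lowerPart M = 0 ↔ ∀ ι γ, γ ≤ ι → M ι γ = 0 := by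
  constructor
  · intro h ι γ hγ
    have := congrFun (congrFun h ι) γ
    simpa [lowerPart_apply, hγ] using this
  · intro h
    ext ι γ
    by_cases hγ : γ ≤ ι
    · simp [lowerPart_apply, hγ, h ι γ hγ]
    · simp [lowerPart_apply, hγ]

theorem lowerPart_mul_left {U N : Matrix (Fin n) (Fin n) A} (hU : U.IsUpperTriangular)
    (hN : lowerPart N = 0) : lowerPart (U * N) = 0 := by
  rw [lowerPart_eq_zero_iff] at hN ⊢
  intro ι γ h
  rw [Matrix.mul_apply]
  refine Finset.sum_eq_zero fun k _ => ?_
  rcases lt_or_ge k ι with hk | hk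
  · rw [hU hk, zero_mul]
  · rw [hN k γ (h.trans hk), mul_zero]

theorem lowerPart_mul_right {U N : Matrix (Fin n) (Fin n) A} (hU : U.IsUpperTriangular)
    (hN : lowerPart N = 0) : lowerPart (N * U) = 0 := by
  rw [lowerPart_eq_zero_iff] at hN ⊢
  intro ι γ h
  rw [Matrix.mul_apply]
  refine Finset.sum_eq_zero fun k _ => ?_
  rcases lt_or_ge γ k with hk | hk
  · rw [hU hk, mul_zero]
  · rw [hN ι k (hk.trans h), zero_mul]

theorem lowerPart_lowerPart (M : Matrix (Fin n) (Fin n) A) :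
    lowerPart (lowerPart M) = lowerPart M := by
  ext ι γ
  by_cases h : γ ≤ ι <;> simp [lowerPart_apply, h]

theorem lowerPart_isLowerTriangular (M : Matrix (Fin n) (Fin n) A) :
    (lowerPart M).IsLowerTriangular := by
  intro ι γ h
  have h' : ι < γ := h
  simp [lowerPart_apply, h']

theorem lowerPart_of_isLowerTriangular {M : Matrix (Fin n) (Fin n) A}
    (hM : M.IsLowerTriangular) : lowerPart M = M := by
  ext ι γ
  by_cases h : γ ≤ ι
  · simp [lowerPart_apply, h]
  · have : M ι γ = 0 := hM (OrderDual.toDual_lt_toDual.2 (not_le.1 h))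
    simp [lowerPart_apply, h, this]

theorem lowerPart_map {A' : Type*} [CommRing A'] (φ : A →+* A')
    (M : Matrix (Fin n) (Fin n) A) : lowerPart (M.map φ) = (lowerPart M).map φ := by
  ext ι γ
  by_cases h : γ ≤ ι <;> simp [lowerPart_apply, h]

theorem lowerPart_conj_lowerPart {U V : Matrix (Fin n) (Fin n) A} (hU : U.IsUpperTriangular)
    (hV : V.IsUpperTriangular) (M : Matrix (Fin n) (Fin n) A) :
    lowerPart (U * lowerPart M * V) = lowerPart (U * M * V) := by
  rw [← sub_eq_zero, ← map_sub, ← sub_mul, ← mul_sub]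
  refine lowerPart_mul_right hV (lowerPart_mul_left hU ?_)
  rw [map_sub, lowerPart_lowerPart, sub_self]

end lowerPart

/-! ### The cotangent bundle, the action of `B` and the moment map -/

/-- `A`-valued points of `T*(𝔟 × ℂⁿ) = 𝔟 × 𝔟* × ℂⁿ × (ℂⁿ)*`: `r` is upper triangular, `s` is the
lower triangular representative of an element of `𝔟* = 𝔤𝔩_n / 𝔲⁺`, `i` is a column vector and
`j` is a row vector. -/
@[ext]
structure CotangentPoint (n : ℕ) (A : Type*) [CommRing A] where
  r : Matrix (Fin n) (Fin n) A
  s : Matrix (Fin n) (Fin n) A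
  i : Fin n → A
  j : Fin n → A
  r_upper : r.IsUpperTriangular
  s_lower : s.IsLowerTriangular

namespace CotangentPoint

variable {n : ℕ} {A : Type*} [CommRing A]

/-- Base change of points along a ring homomorphism. -/
def map {A' : Type*} [CommRing A'] (φ : A →+* A') (p : CotangentPoint n A) :
    CotangentPoint n A' where
  r := p.r.map φ
  s := p.s.map φ
  i := φ ∘ p.i
  j := φ ∘ p.j
  r_upper ι γ h := by simp [p.r_upper h]
  s_lower ι γ h := by simp [p.s_lower h]

/-- The action `b • (r, s, i, j) = (b r b⁻¹, b s b⁻¹, b i, j b⁻¹)`, where `b s b⁻¹` is taken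
in `𝔟* = 𝔤𝔩_n / 𝔲⁺`. -/
instance [Algebra ℂ A] : MulAction (Borel n) (CotangentPoint n A) where
  smul b p :=
    { r := (Borel.toGL A b).1 * p.r * (Borel.toGL A b⁻¹).1
      s := lowerPart ((Borel.toGL A b).1 * p.s * (Borel.toGL A b⁻¹).1)
      i := (Borel.toGL A b).1 *ᵥ p.i
      j := p.j ᵥ* (Borel.toGL A b⁻¹).1
      r_upper := ((Borel.toGL_upper A b).mul p.r_upper).mul (Borel.toGL_upper A b⁻¹)
      s_lower := lowerPart_isLowerTriangular _ }
  one_smul p := by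
    ext1
    · change (Borel.toGL A 1).1 * p.r * (Borel.toGL A 1⁻¹).1 = p.r
      simp
    · change lowerPart ((Borel.toGL A 1).1 * p.s * (Borel.toGL A 1⁻¹).1) = p.s
      simp [lowerPart_of_isLowerTriangular p.s_lower]
    · change (Borel.toGL A 1).1 *ᵥ p.i = p.i
      simp
    · change p.j ᵥ* (Borel.toGL A 1⁻¹).1 = p.j
      simp
  mul_smul a b p := by
    ext1
    · change (Borel.toGL A (a * b)).1 * p.r * (Borel.toGL A (a * b)⁻¹).1 =
        (Borel.toGL A a).1 * ((Borel.toGL A b).1 * p.r * (Borel.toGL A b⁻¹).1) *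
          (Borel.toGL A a⁻¹).1
      rw [_root_.mul_inv_rev, map_mul, map_mul, Units.val_mul, Units.val_mul]
      simp only [Matrix.mul_assoc]
    · change lowerPart ((Borel.toGL A (a * b)).1 * p.s * (Borel.toGL A (a * b)⁻¹).1) =
        lowerPart ((Borel.toGL A a).1 *
          lowerPart ((Borel.toGL A b).1 * p.s * (Borel.toGL A b⁻¹).1) * (Borel.toGL A a⁻¹).1)
      rw [lowerPart_conj_lowerPart (Borel.toGL_upper A a) (Borel.toGL_upper A a⁻¹),
        _root_.mul_inv_rev, map_mul (Borel.toGL A), map_mul (Borel.toGL A), Units.val_mul,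
        Units.val_mul]
      simp only [Matrix.mul_assoc]
    · change (Borel.toGL A (a * b)).1 *ᵥ p.i = (Borel.toGL A a).1 *ᵥ ((Borel.toGL A b).1 *ᵥ p.i)
      rw [map_mul, Units.val_mul, Matrix.mulVec_mulVec]
    · change p.j ᵥ* (Borel.toGL A (a * b)⁻¹).1 =
        (p.j ᵥ* (Borel.toGL A b⁻¹).1) ᵥ* (Borel.toGL A a⁻¹).1
      rw [_root_.mul_inv_rev, map_mul, Units.val_mul, Matrix.vecMul_vecMul]

/-- The moment map `μ(r, s, i, j) = [r, s] + i j`, with values in `𝔟* = 𝔤𝔩_n / 𝔲⁺`. -/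
def moment (p : CotangentPoint n A) : Matrix (Fin n) (Fin n) A :=
  lowerPart (p.r * p.s - p.s * p.r + vecMulVec p.i p.j)

theorem moment_map {A' : Type*} [CommRing A'] (φ : A →+* A') (p : CotangentPoint n A) :
    (p.map φ).moment = p.moment.map φ := by
  rw [moment, moment, ← lowerPart_map]
  congr 1
  ext ι γ
  simp [map, Matrix.mul_apply, vecMulVec_apply]

theorem moment_smul [Algebra ℂ A] (b : Borel n) (p : CotangentPoint n A)
    (hp : p.moment = 0) : (b • p).moment = 0 := by
  set g := (Borel.toGL A b).1 with hg
  set h := (Borel.toGL A b⁻¹).1 with hh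
  have hgU : g.IsUpperTriangular := Borel.toGL_upper A b
  have hhU : h.IsUpperTriangular := Borel.toGL_upper A b⁻¹
  have hhg : h * g = 1 := by rw [hg, hh, ← Units.val_mul, ← map_mul]; simp
  have hrU : (g * p.r * h).IsUpperTriangular := (hgU.mul p.r_upper).mul hhU
  change lowerPart (g * p.r * h * lowerPart (g * p.s * h) - lowerPart (g * p.s * h) * (g * p.r * h)
    + vecMulVec (g *ᵥ p.i) (p.j ᵥ* h)) = 0
  have key : g * p.r * h * lowerPart (g * p.s * h) - lowerPart (g * p.s * h) * (g * p.r * h)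
      + vecMulVec (g *ᵥ p.i) (p.j ᵥ* h) =
      g * (p.r * p.s - p.s * p.r + vecMulVec p.i p.j) * h
      + (g * p.r * h * (lowerPart (g * p.s * h) - g * p.s * h)
        - (lowerPart (g * p.s * h) - g * p.s * h) * (g * p.r * h)) := by
    have e1 : g * p.r * h * (g * p.s * h) = g * (p.r * p.s) * h := by
      calc g * p.r * h * (g * p.s * h) = g * p.r * (h * g) * (p.s * h) := by
            simp only [Matrix.mul_assoc]
        _ = _ := by rw [hhg]; simp only [Matrix.mul_assoc, Matrix.one_mul]
    have e2 : g * p.s * h * (g * p.r * h) = g * (p.s * p.r) * h := by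
      calc g * p.s * h * (g * p.r * h) = g * p.s * (h * g) * (p.r * h) := by
            simp only [Matrix.mul_assoc]
        _ = _ := by rw [hhg]; simp only [Matrix.mul_assoc, Matrix.one_mul]
    have e3 : vecMulVec (g *ᵥ p.i) (p.j ᵥ* h) = g * vecMulVec p.i p.j * h := by
      rw [Matrix.mul_vecMulVec, Matrix.vecMulVec_mul]
    rw [mul_sub, sub_mul, e1, e2, e3, mul_add, mul_sub, add_mul, sub_mul]
    abel
  have h0 : lowerPart (lowerPart (g * p.s * h) - g * p.s * h) = 0 := by
    rw [map_sub, lowerPart_lowerPart, sub_self]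
  rw [key, map_add, map_sub, lowerPart_mul_left hrU h0, lowerPart_mul_right hrU h0,
    lowerPart_mul_right hhU (lowerPart_mul_left hgU hp)]
  simp

end CotangentPoint

/-! ### The regular semisimple locus of `μ⁻¹(0)` -/

/-- `A`-valued points of `μ⁻¹(0)^{rss}`: points of `T*(𝔟 × ℂⁿ)` with `[r, s] + i j = 0` in `𝔟*`
such that the characteristic polynomial of `r` is separable. For `A = ℂ` the last condition says
that the eigenvalues of `r` are pairwise distinct. -/
@[ext]
structure RssPoint (n : ℕ) (A : Type*) [CommRing A] extends CotangentPoint n A where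
  moment_eq_zero : toCotangentPoint.moment = 0
  separable : r.charpoly.Separable

namespace RssPoint

theorem isUnit_sub {n : ℕ} {A : Type*} [CommRing A] (z : RssPoint n A) {ι γ : Fin n}
    (h : ι ≠ γ) : IsUnit (z.r ι ι - z.r γ γ) := by
  have hs := z.separable
  rw [Matrix.charpoly_of_isUpperTriangular _ z.r_upper,
    ← Finset.mul_prod_erase _ _ (Finset.mem_univ ι),
    ← Finset.mul_prod_erase _ _ (Finset.mem_erase.2 ⟨h.symm, Finset.mem_univ γ⟩),
    ← mul_assoc] at hs
  obtain ⟨u, v, huv⟩ := hs.of_mul_left.isCoprime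
  have := congrArg (Polynomial.eval (z.r ι ι)) huv
  simp only [Polynomial.eval_add, Polynomial.eval_mul, Polynomial.eval_sub, Polynomial.eval_X,
    Polynomial.eval_C, sub_self, mul_zero, zero_add, Polynomial.eval_one] at this
  exact IsUnit.of_mul_eq_one _ ((mul_comm _ _).trans this)

instance {n : ℕ} {A : Type*} [CommRing A] [Algebra ℂ A] :
    MulAction (Borel n) (RssPoint n A) where
  smul b z :=
    { toCotangentPoint := b • z.toCotangentPoint
      moment_eq_zero := CotangentPoint.moment_smul b _ z.moment_eq_zero
      separable := by
        change (((Borel.toGL A b).1 * z.r * (Borel.toGL A b⁻¹).1).charpoly).Separable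
        have h := Matrix.charpoly_units_conj (Borel.toGL A b) z.r
        rw [← Matrix.coe_units_inv, ← map_inv] at h
        rw [h]
        exact z.separable }
  one_smul z := by
    obtain ⟨p, h₁, h₂⟩ := z
    have h := one_smul (Borel n) p
    change RssPoint.mk ((1 : Borel n) • p) _ _ = _
    congr
  mul_smul a b z := by
    obtain ⟨p, h₁, h₂⟩ := z
    have h := mul_smul a b p
    change RssPoint.mk ((a * b) • p) _ _ = RssPoint.mk (a • b • p) _ _
    congr

end RssPoint

/-! ### The function `s'` -/

/-- `∏_{k ≠ ι} (r - r_{kk} I)`. -/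
def prodL {n : ℕ} {A : Type*} [CommRing A] (r : Matrix (Fin n) (Fin n) A) (ι : Fin n) :
    Matrix (Fin n) (Fin n) A :=
  (((List.finRange n).filter (fun k => k ≠ ι)).map
    fun k => r - r k k • (1 : Matrix (Fin n) (Fin n) A)).prod

/-- `s'_{ιι} = [tr ∏_{k ≠ ι} (r - r_{kk} I)]⁻¹ tr (∏_{k ≠ ι} (r - r_{kk} I) s)`.
The trace that is inverted is `∏_{k ≠ ι} (r_{ιι} - r_{kk})`, a unit on the regular
semisimple locus. -/
def CotangentPoint.sPrime {n : ℕ} {A : Type*} [CommRing A] (p : CotangentPoint n A)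
    (ι : Fin n) : A :=
  Ring.inverse (prodL p.r ι).trace * (prodL p.r ι * p.s).trace

/-! ### Coordinate rings -/

/-- `∏_{ι < γ} (d_γ - d_ι)` -/
def prodDiff {n : ℕ} {A : Type*} [CommRing A] (d : Fin n → A) : A :=
  ∏ q ∈ Finset.univ.filter (fun q : Fin n × Fin n => q.1 < q.2), (d q.2 - d q.1)

theorem isUnit_prodDiff {n : ℕ} {A : Type*} [CommRing A] {d : Fin n → A} :
    IsUnit (prodDiff d) ↔ ∀ ι γ, ι < γ → IsUnit (d γ - d ι) := by
  rw [prodDiff, IsUnit.prod_iff]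
  exact ⟨fun h ι γ hlt => h (ι, γ) (by simp [hlt]), fun h q hq => h q.1 q.2 (by simpa using hq)⟩

theorem map_prodDiff {n : ℕ} {A A' : Type*} [CommRing A] [CommRing A'] (φ : A →+* A')
    (d : Fin n → A) : φ (prodDiff d) = prodDiff fun ι => φ (d ι) := by
  simp [prodDiff, map_prod]

/-- The coordinates on `T*(𝔟 × ℂⁿ)`: `r_{ιγ}` with `ι ≤ γ`, `s_{ιγ}` with `ι ≥ γ`,
the entries `x_k` of `i` and the entries `y_k` of `j`. -/
inductive Coord (n : ℕ) : Type
  | r (ι γ : Fin n) (h : ι ≤ γ) : Coord n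
  | s (ι γ : Fin n) (h : γ ≤ ι) : Coord n
  | x (k : Fin n) : Coord n
  | y (k : Fin n) : Coord n

/-- The values of the coordinates at a point. -/
def CotangentPoint.coord {n : ℕ} {A : Type*} [CommRing A] (p : CotangentPoint n A) :
    Coord n → A
  | .r ι γ _ => p.r ι γ
  | .s ι γ _ => p.s ι γ
  | .x k => p.i k
  | .y k => p.j k

/-- `ℂ[T*(𝔟 × ℂⁿ)]`. -/
abbrev CotangentRing (n : ℕ) : Type := MvPolynomial (Coord n) ℂ

/-- The tautological point of `T*(𝔟 × ℂⁿ)`, whose entries are the coordinate functions. -/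
def genericPoint (n : ℕ) : CotangentPoint n (CotangentRing n) where
  r := Matrix.of fun ι γ => if h : ι ≤ γ then MvPolynomial.X (.r ι γ h) else 0
  s := Matrix.of fun ι γ => if h : γ ≤ ι then MvPolynomial.X (.s ι γ h) else 0
  i k := MvPolynomial.X (.x k)
  j k := MvPolynomial.X (.y k)
  r_upper ι γ h := by
    have h' : γ < ι := h
    simp [h']
  s_lower ι γ h := by
    have h' : ι < γ := h
    simp [h']

theorem genericPoint_map_aeval {n : ℕ} {A : Type*} [CommRing A] [Algebra ℂ A]
    (p : CotangentPoint n A) :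
    (genericPoint n).map (MvPolynomial.aeval (R := ℂ) p.coord).toRingHom = p := by
  ext ι
  · rename_i γ
    by_cases h : ι ≤ γ
    · simp [CotangentPoint.map, genericPoint, h, CotangentPoint.coord]
    · have : p.r ι γ = 0 := p.r_upper (not_le.1 h)
      simp [CotangentPoint.map, genericPoint, h, this]
  · rename_i γ
    by_cases h : γ ≤ ι
    · simp [CotangentPoint.map, genericPoint, h, CotangentPoint.coord]
    · have : p.s ι γ = 0 := p.s_lower (OrderDual.toDual_lt_toDual.2 (not_le.1 h))
      simp [CotangentPoint.map, genericPoint, h, this]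
  · simp [CotangentPoint.map, genericPoint, CotangentPoint.coord]
  · simp [CotangentPoint.map, genericPoint, CotangentPoint.coord]

/-- `∏_{ι < γ} (r_{γγ} - r_{ιι})` -/
def discr (n : ℕ) : CotangentRing n := prodDiff fun ι => (genericPoint n).r ι ι

/-- `ℂ[T*(𝔟 × ℂⁿ)^{rss}] = ℂ[r, s, x, y][(r_{νν} - r_{γγ})⁻¹]`. -/
abbrev CotangentRssRing (n : ℕ) : Type := Localization.Away (discr n)

/-- The ideal generated by the entries of the moment map. -/
def momentIdeal (n : ℕ) : Ideal (CotangentRssRing n) :=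
  Ideal.span (Set.range fun q : Fin n × Fin n =>
    algebraMap (CotangentRing n) (CotangentRssRing n) ((genericPoint n).moment q.1 q.2))

/-- The coordinate ring `ℂ[μ⁻¹(0)^{rss}] = ℂ[T*(𝔟 × ℂⁿ)^{rss}] / ⟨μ(r, s, i, j)_{ιγ}⟩`. -/
abbrev RssRing (n : ℕ) : Type := CotangentRssRing n ⧸ momentIdeal n

/-- The structure map `ℂ[T*(𝔟 × ℂⁿ)] → ℂ[μ⁻¹(0)^{rss}]`. -/
def toRssRing (n : ℕ) : CotangentRing n →ₐ[ℂ] RssRing n :=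
  (Ideal.Quotient.mkₐ ℂ (momentIdeal n)).comp
    (IsScalarTower.toAlgHom ℂ (CotangentRing n) (CotangentRssRing n))

theorem isUnit_toRssRing_discr (n : ℕ) : IsUnit ((toRssRing n).toRingHom (discr n)) :=
  (IsLocalization.Away.algebraMap_isUnit (S := CotangentRssRing n) (discr n)).map
    (Ideal.Quotient.mkₐ ℂ (momentIdeal n))

theorem separable_of_isUnit {n : ℕ} {A : Type*} [CommRing A] {r : Matrix (Fin n) (Fin n) A}
    (hr : r.IsUpperTriangular) (h : ∀ ι γ, ι < γ → IsUnit (r γ γ - r ι ι)) :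
    r.charpoly.Separable := by
  rw [Matrix.charpoly_of_isUpperTriangular _ hr]
  refine Polynomial.separable_prod (fun ι γ hne => ?_) fun ι => Polynomial.separable_X_sub_C
  refine Polynomial.isCoprime_X_sub_C_of_isUnit_sub ?_
  rcases lt_or_gt_of_ne hne with hlt | hlt
  · have := (h ι γ hlt).neg
    rwa [neg_sub] at this
  · exact h γ ι hlt

theorem isUnit_aeval_powers {n : ℕ} {A : Type*} [CommRing A] [Algebra ℂ A] (z : RssPoint n A)
    (f : Submonoid.powers (discr n)) :
    IsUnit (MvPolynomial.aeval (R := ℂ) z.coord (f : CotangentRing n)) := by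
  have hr : ∀ ι γ, MvPolynomial.aeval (R := ℂ) z.coord ((genericPoint n).r ι γ) = z.r ι γ :=
    fun ι γ => congrFun (congrFun
      (congrArg CotangentPoint.r (genericPoint_map_aeval z.toCotangentPoint)) ι) γ
  obtain ⟨_, k, rfl⟩ := f
  change IsUnit (MvPolynomial.aeval (R := ℂ) z.coord (discr n ^ k))
  rw [map_pow]
  refine IsUnit.pow _ ?_
  have h : IsUnit ((MvPolynomial.aeval (R := ℂ) z.coord).toRingHom (discr n)) := by
    rw [discr, map_prodDiff]
    refine isUnit_prodDiff.2 fun ι γ hlt => ?_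
    change IsUnit (MvPolynomial.aeval (R := ℂ) z.coord _ - MvPolynomial.aeval (R := ℂ) z.coord _)
    rw [hr, hr]
    exact z.isUnit_sub hlt.ne'
  exact h

/-- The tautological point of `μ⁻¹(0)^{rss}`, whose entries are the coordinate functions in
`ℂ[μ⁻¹(0)^{rss}]`. -/
def univPoint (n : ℕ) : RssPoint n (RssRing n) where
  toCotangentPoint := (genericPoint n).map (toRssRing n).toRingHom
  moment_eq_zero := by
    rw [CotangentPoint.moment_map]
    ext ι γ
    exact Ideal.Quotient.eq_zero_iff_mem.2 (Ideal.subset_span ⟨(ι, γ), rfl⟩)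
  separable := separable_of_isUnit ((genericPoint n).map _).r_upper <| by
    have e := map_prodDiff (toRssRing n).toRingHom fun ι => (genericPoint n).r ι ι
    exact isUnit_prodDiff.1 (e ▸ isUnit_toRssRing_discr n)

/-- Evaluation of functions in `ℂ[T*(𝔟 × ℂⁿ)^{rss}]` at an `A`-valued point. -/
def evalLoc {n : ℕ} {A : Type*} [CommRing A] [Algebra ℂ A] (z : RssPoint n A) :
    CotangentRssRing n →ₐ[ℂ] A :=
  IsLocalization.liftAlgHom (M := Submonoid.powers (discr n)) (S := CotangentRssRing n)
    (f := MvPolynomial.aeval (R := ℂ) z.coord) (isUnit_aeval_powers z)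

theorem evalLoc_algebraMap {n : ℕ} {A : Type*} [CommRing A] [Algebra ℂ A] (z : RssPoint n A)
    (f : CotangentRing n) : evalLoc z (algebraMap _ _ f) = MvPolynomial.aeval z.coord f :=
  IsLocalization.lift_eq _ _

theorem evalLoc_eq_zero {n : ℕ} {A : Type*} [CommRing A] [Algebra ℂ A] (z : RssPoint n A)
    (a : CotangentRssRing n) (ha : a ∈ momentIdeal n) : evalLoc z a = 0 := by
  have hle : momentIdeal n ≤ RingHom.ker (evalLoc z) := by
    rw [momentIdeal, Ideal.span_le]
    rintro _ ⟨q, rfl⟩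
    have hm := CotangentPoint.moment_map
      (MvPolynomial.aeval (R := ℂ) z.coord).toRingHom (genericPoint n)
    rw [genericPoint_map_aeval, z.moment_eq_zero] at hm
    have h := (congrFun (congrFun hm q.1) q.2).symm
    change evalLoc z (algebraMap _ _ _) = 0
    rw [evalLoc_algebraMap]
    exact h
  exact hle ha

/-- Evaluation of functions in `ℂ[μ⁻¹(0)^{rss}]` at an `A`-valued point of `μ⁻¹(0)^{rss}`. -/
def evalAt {n : ℕ} {A : Type*} [CommRing A] [Algebra ℂ A] (z : RssPoint n A) :
    RssRing n →ₐ[ℂ] A :=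
  Ideal.Quotient.liftₐ (momentIdeal n) (evalLoc z) (evalLoc_eq_zero z)

/-- The action of `b ∈ B` on functions, `f ↦ (z ↦ f (b • z))`. -/
def translate {n : ℕ} (b : Borel n) : RssRing n →ₐ[ℂ] RssRing n := evalAt (b • univPoint n)

/-- The ring of invariants `ℂ[μ⁻¹(0)^{rss}]^B`. -/
def invariants (n : ℕ) : Subalgebra ℂ (RssRing n) :=
  ⨅ b : Borel n, AlgHom.equalizer (translate b) (AlgHom.id ℂ (RssRing n))

/-- The affine quotient `μ⁻¹(0)^{rss} // B = Spec ℂ[μ⁻¹(0)^{rss}]^B`. -/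
def affineQuotient (n : ℕ) : Scheme := Spec (CommRingCat.of (invariants n))

/-- The quotient morphism `μ⁻¹(0)^{rss} → μ⁻¹(0)^{rss} // B`. -/
def quotientMap (n : ℕ) : Spec (CommRingCat.of (RssRing n)) ⟶ affineQuotient n :=
  Spec.map (CommRingCat.ofHom (invariants n).val.toRingHom)

/-! ### The space `ℂ^{2n} \ Δ_n` -/

/-- `ℂ[ℂ^{2n}]`, with coordinates `x_{ιι}` (left summand) and `y_{ιι}` (right summand). -/
abbrev PlaneRing (n : ℕ) : Type := MvPolynomial (Fin n ⊕ Fin n) ℂ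

/-- The affine space `ℂ^{2n}`. -/
abbrev plane (n : ℕ) : Scheme := Spec (CommRingCat.of (PlaneRing n))

/-- `Δ_n`, the union of the hyperplanes `x_{ιι} = x_{γγ}` with `ι ≠ γ`. -/
def diagonalLocus (n : ℕ) : Set (PrimeSpectrum (PlaneRing n)) :=
  ⋃ q : {q : Fin n × Fin n // q.1 ≠ q.2},
    PrimeSpectrum.zeroLocus {MvPolynomial.X (Sum.inl q.1.1) - MvPolynomial.X (Sum.inl q.1.2)}

/-- The open subscheme `ℂ^{2n} \ Δ_n` of `ℂ^{2n}`. -/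
def planeMinusDelta (n : ℕ) : (plane n).Opens where
  carrier := (diagonalLocus n)ᶜ
  is_open' := (isClosed_iUnion_of_finite fun _ =>
    PrimeSpectrum.isClosed_zeroLocus _).isOpen_compl

/-- `∏_{γ < ν} (r_{νν} - r_{γγ})`, in the coordinates of `ℂ^{2n}`. -/
def planeDiscr (n : ℕ) : PlaneRing n :=
  prodDiff fun ι => MvPolynomial.X (Sum.inl ι)

/-- `ℂ[r_{11}, …, r_{nn}, s'_{11}, …, s'_{nn}][(r_{νν} - r_{γγ})⁻¹]`. -/
abbrev PlaneRssRing (n : ℕ) : Type := Localization.Away (planeDiscr n)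

/-- The morphism `μ⁻¹(0)^{rss} → ℂ^{2n}`,
`(r, s, i, j) ↦ (r_{11}, …, r_{nn}, s'_{11}, …, s'_{nn})`. -/
def morphismP (n : ℕ) : Spec (CommRingCat.of (RssRing n)) ⟶ plane n :=
  Spec.map (CommRingCat.ofHom (MvPolynomial.aeval (R := ℂ)
    (Sum.elim (fun ι => (univPoint n).r ι ι) fun ι => (univPoint n).sPrime ι)).toRingHom)

/-! ### Closed points, in the Zariski topology -/

/-- The Zariski topology on the set of `ℂ`-points of `μ⁻¹(0)^{rss}`, induced from the affine space
`T*(𝔟 × ℂⁿ)`. -/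
instance (n : ℕ) : TopologicalSpace (RssPoint n ℂ) :=
  TopologicalSpace.induced
    (fun z => (MvPolynomial.pointToPoint (k := ℂ) z.coord : PrimeSpectrum (CotangentRing n)))
    inferInstance

/-- The `ℂ`-points `(x, y)` of `ℂ^{2n} \ Δ_n`: the `x_{ιι}` are pairwise distinct. -/
@[ext]
structure PlanePoint (n : ℕ) where
  x : Fin n → ℂ
  y : Fin n → ℂ
  x_injective : Function.Injective x

/-- The point of the scheme `ℂ^{2n}` given by a `ℂ`-point. -/
def PlanePoint.toPlane {n : ℕ} (w : PlanePoint n) : PrimeSpectrum (PlaneRing n) :=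
  MvPolynomial.pointToPoint (k := ℂ) (Sum.elim w.x w.y)

/-- The Zariski topology on `ℂ^{2n} \ Δ_n`. -/
instance (n : ℕ) : TopologicalSpace (PlanePoint n) :=
  TopologicalSpace.induced PlanePoint.toPlane inferInstance

/-- The map `P : μ⁻¹(0)^{rss} → ℂ^{2n} \ Δ_n`,
`(r, s, i, j) ↦ (r_{11}, …, r_{nn}, s'_{11}, …, s'_{nn})`. -/
def mapP {n : ℕ} (z : RssPoint n ℂ) : PlanePoint n where
  x ι := z.r ι ι
  y ι := z.sPrime ι
  x_injective ι γ h := by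
    by_contra hne
    exact (z.isUnit_sub hne).ne_zero (sub_eq_zero.2 h)

/-- Two points are related if the closures of their `B`-orbits in `μ⁻¹(0)^{rss}` meet. -/
def closuresMeet {n : ℕ} (z w : RssPoint n ℂ) : Prop :=
  (closure (MulAction.orbit (Borel n) z) ∩ closure (MulAction.orbit (Borel n) w)).Nonempty

/-- The space of orbit closures: the quotient of `μ⁻¹(0)^{rss}`, with the quotient topology,
by the identification of points whose orbit closures meet. -/
abbrev OrbitClosureSpace (n : ℕ) : Type := Quot (closuresMeet (n := n))

/-- The point of `Spec ℂ[μ⁻¹(0)^{rss}]` given by a `ℂ`-point of `μ⁻¹(0)^{rss}`. -/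
def RssPoint.toSpec {n : ℕ} (z : RssPoint n ℂ) : PrimeSpectrum (RssRing n) :=
  PrimeSpectrum.comap (evalAt z).toRingHom ⊥

end BorelMoment

end

open CategoryTheory AlgebraicGeometry Matrix

noncomputable section

namespace BorelMoment

/-! ### Functoriality of points -/

/-! Since the diagonal entries of `r` differ by units, `r` is diagonalised inside the Borel group,
canonically and over any base ring: the columns and rows of `∏_{k ≠ ι} (r - r_{kk})` through its
`(ι, ι)` entry are right and left eigenvectors (`mul_prodL`, `eigenRows_mul_eigenColumns`). So every
point is conjugate to one with `r = diag(d)`. There the moment equation reads `(d_ι - d_γ) s_{ιγ} +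
x_ι y_γ = 0` for `γ ≤ ι`: it determines `s` below the diagonal, leaves the diagonal of `s` free, and
forces `x_ι y_ι = 0`. On this slice `s'_{ιι}` is just `s_{ιι}`, and `r_{ιι}`, `s'_{ιι}` are
invariant under conjugation.

Because `x_ι` or `y_ι` vanishes for each `ι`, the torus can scale `i` and `j` simultaneously by any
`τ ≠ 0` (`slice_scale_mem_orbit`). Letting `τ` tend to `0` puts `diagonalPoint (mapP z)`, where `s`
is diagonal and `i = j = 0`, into the closure of the orbit of `z`. Conversely `P` is continuous and
constant on orbits, hence on their closures. So `P` separates points exactly up to meeting closures,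
and `diagonalPoint` is a continuous section, which gives the homeomorphism.

For the invariants, restriction to the diagonal points is inverse to the comorphism. One composite
is the identity because `P` is the identity on diagonal points. For the other, an invariant function
has the same value at `z` and at `diagonalPoint (mapP z)`; to conclude from values at closed points,
the coordinate ring must be reduced. It embeds in a localisation of `ℂ[r, s, x, y] / (x_k y_k)`
(`evalAt_normalPoint_injective`), and that squarefree monomial ideal is radical
(`isRadical_span_X_mul_X`). The scheme statement follows: the invariants are the localisation of
`ℂ[ℂ^{2n}]` at the discriminant, whose basic open set is the complement of `Δ_n`. -/

theorem isUpperTriangular_mul_apply_self {n : ℕ} {A : Type*} [CommRing A]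
    {M N : Matrix (Fin n) (Fin n) A} (hM : M.IsUpperTriangular) (hN : N.IsUpperTriangular)
    (ι : Fin n) : (M * N) ι ι = M ι ι * N ι ι := by
  rw [Matrix.mul_apply, Finset.sum_eq_single ι]
  · intro k _ hk
    rcases lt_or_gt_of_ne hk with h | h
    · rw [hM h, zero_mul]
    · rw [hN h, mul_zero]
  · simp

theorem RssPoint.ext' {n : ℕ} {A : Type*} [CommRing A] {z w : RssPoint n A}
    (h : z.toCotangentPoint = w.toCotangentPoint) : z = w := by
  cases z; cases w; cases h; rfl

/-- Base change of points of `μ⁻¹(0)^{rss}` along a ring homomorphism. -/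
def RssPoint.map {n : ℕ} {A A' : Type*} [CommRing A] [CommRing A'] (φ : A →+* A')
    (z : RssPoint n A) : RssPoint n A' where
  toCotangentPoint := z.toCotangentPoint.map φ
  moment_eq_zero := by
    rw [CotangentPoint.moment_map, z.moment_eq_zero]
    ext; simp
  separable := separable_of_isUnit (z.toCotangentPoint.map φ).r_upper fun ι γ h => by
    have := (z.isUnit_sub h.ne').map φ
    rwa [map_sub] at this

theorem CotangentPoint.coord_map {n : ℕ} {A A' : Type*} [CommRing A] [CommRing A']
    (φ : A →+* A') (p : CotangentPoint n A) (c : Coord n) : (p.map φ).coord c = φ (p.coord c) := by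
  cases c <;> rfl

theorem CotangentPoint.map_map {n : ℕ} {A A' A'' : Type*} [CommRing A] [CommRing A']
    [CommRing A''] (φ : A →+* A') (ψ : A' →+* A'') (p : CotangentPoint n A) :
    (p.map φ).map ψ = p.map (ψ.comp φ) := rfl

theorem genericPoint_coord (n : ℕ) (c : Coord n) :
    (genericPoint n).coord c = MvPolynomial.X c := by
  cases c <;> simp [genericPoint, CotangentPoint.coord, *]

theorem CotangentPoint.ext_coord {n : ℕ} {A : Type*} [CommRing A] {p q : CotangentPoint n A}
    (h : ∀ c, p.coord c = q.coord c) : p = q := by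
  ext ι
  · rename_i γ
    by_cases hc : ι ≤ γ
    · exact h (.r ι γ hc)
    · rw [p.r_upper (not_le.1 hc), q.r_upper (not_le.1 hc)]
  · rename_i γ
    by_cases hc : γ ≤ ι
    · exact h (.s ι γ hc)
    · rw [p.s_lower (OrderDual.toDual_lt_toDual.2 (not_le.1 hc)),
        q.s_lower (OrderDual.toDual_lt_toDual.2 (not_le.1 hc))]
  · exact h (.x ι)
  · exact h (.y ι)

section eval

variable {n : ℕ} {A A' : Type*} [CommRing A] [Algebra ℂ A] [CommRing A'] [Algebra ℂ A']

theorem evalAt_toRssRing (z : RssPoint n A) (f : CotangentRing n) :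
    evalAt z (toRssRing n f) = MvPolynomial.aeval z.coord f :=
  evalLoc_algebraMap z f

theorem univPoint_coord (c : Coord n) :
    (univPoint n).coord c = toRssRing n (MvPolynomial.X c) := by
  rw [← genericPoint_coord]
  exact CotangentPoint.coord_map _ _ c

/-- The ring is a quotient of a localisation of a polynomial ring, and both passages are
epimorphisms. Together with `evalAt` this makes `RssRing n` represent the functor of `A`-valued
points. -/
theorem algHom_ext_toRssRing {φ ψ : RssRing n →ₐ[ℂ] A}
    (h : ∀ c, φ ((univPoint n).coord c) = ψ ((univPoint n).coord c)) : φ = ψ := by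
  have h1 : φ.comp (toRssRing n) = ψ.comp (toRssRing n) := by
    refine MvPolynomial.algHom_ext fun c => ?_
    simpa [univPoint_coord] using h c
  have h2 : (φ.comp (Ideal.Quotient.mkₐ ℂ (momentIdeal n))) =
      (ψ.comp (Ideal.Quotient.mkₐ ℂ (momentIdeal n))) := by
    refine AlgHom.coe_ringHom_injective
      (IsLocalization.ringHom_ext (Submonoid.powers (discr n)) ?_)
    refine MvPolynomial.ringHom_ext (fun c => ?_) fun c => ?_
    · exact congrArg (fun f : CotangentRing n →ₐ[ℂ] A => f (MvPolynomial.C c)) h1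
    · exact congrArg (fun f : CotangentRing n →ₐ[ℂ] A => f (MvPolynomial.X c)) h1
  exact Ideal.Quotient.algHom_ext _ h2

/-- Evaluation at `z` sends the tautological point to `z`. -/
theorem univPoint_map_evalAt (z : RssPoint n A) :
    (univPoint n).map (evalAt z : RssRing n →+* A) = z := by
  refine RssPoint.ext' (CotangentPoint.ext_coord fun c => ?_)
  refine (CotangentPoint.coord_map _ _ c).trans ?_
  rw [univPoint_coord]
  exact (evalAt_toRssRing z _).trans (by simp)

theorem evalAt_univPoint_coord (z : RssPoint n A) (c : Coord n) :
    evalAt z ((univPoint n).coord c) = z.coord c := by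
  conv_rhs => rw [← univPoint_map_evalAt z]
  exact (CotangentPoint.coord_map _ _ c).symm

theorem evalAt_map (z : RssPoint n A) (φ : A →ₐ[ℂ] A') :
    evalAt (z.map (φ : A →+* A')) = φ.comp (evalAt z) := by
  refine algHom_ext_toRssRing fun c => ?_
  rw [evalAt_univPoint_coord, AlgHom.comp_apply, evalAt_univPoint_coord]
  exact CotangentPoint.coord_map _ _ c

theorem evalAt_map_apply (z : RssPoint n A) (φ : A →ₐ[ℂ] A') (f : RssRing n) :
    evalAt (z.map (φ : A →+* A')) f = φ (evalAt z f) := by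
  rw [evalAt_map, AlgHom.comp_apply]

theorem evalAt_univPoint : evalAt (univPoint n) = AlgHom.id ℂ (RssRing n) :=
  algHom_ext_toRssRing fun c => evalAt_univPoint_coord _ c

/-- Every homomorphism out of the coordinate ring is the evaluation at a point. -/
theorem evalAt_univPoint_map (φ : RssRing n →ₐ[ℂ] A) :
    evalAt ((univPoint n).map (φ : RssRing n →+* A)) = φ := by
  rw [evalAt_map, evalAt_univPoint, AlgHom.comp_id]

theorem toGL_map (φ : A →ₐ[ℂ] A') (b : Borel n) :
    (Borel.toGL A b).1.map (φ : A →+* A') = (Borel.toGL A' b).1 := by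
  ext ι γ
  simp [Borel.toGL]

/-- The entries of `b` are complex constants, so a `ℂ`-algebra map fixes them. -/
theorem smul_map (b : Borel n) (z : RssPoint n A) (φ : A →ₐ[ℂ] A') :
    (b • z).map (φ : A →+* A') = b • z.map (φ : A →+* A') := by
  refine RssPoint.ext' ?_
  ext1
  · change ((Borel.toGL A b).1 * z.r * (Borel.toGL A b⁻¹).1).map _ =
      (Borel.toGL A' b).1 * z.r.map _ * (Borel.toGL A' b⁻¹).1
    rw [Matrix.map_mul, Matrix.map_mul, toGL_map, toGL_map]
  · change (lowerPart ((Borel.toGL A b).1 * z.s * (Borel.toGL A b⁻¹).1)).map _ =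
      lowerPart ((Borel.toGL A' b).1 * z.s.map _ * (Borel.toGL A' b⁻¹).1)
    rw [← lowerPart_map, Matrix.map_mul, Matrix.map_mul, toGL_map, toGL_map]
  · change (φ : A →+* A') ∘ ((Borel.toGL A b).1 *ᵥ z.i) = (Borel.toGL A' b).1 *ᵥ (_ ∘ z.i)
    rw [← toGL_map φ]
    exact funext fun _ => RingHom.map_mulVec _ _ _ _
  · change (φ : A →+* A') ∘ (z.j ᵥ* (Borel.toGL A b⁻¹).1) = (_ ∘ z.j) ᵥ* (Borel.toGL A' b⁻¹).1
    rw [← toGL_map φ]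
    exact funext fun _ => RingHom.map_vecMul _ _ _ _

theorem evalAt_translate (b : Borel n) (z : RssPoint n A) (f : RssRing n) :
    evalAt z (translate b f) = evalAt (b • z) f := by
  rw [translate, ← evalAt_map_apply, smul_map, univPoint_map_evalAt]

theorem mem_invariants {f : RssRing n} : f ∈ invariants n ↔ ∀ b : Borel n, translate b f = f := by
  simp [invariants, Algebra.mem_iInf]

end eval

theorem prodL_map {n : ℕ} {A A' : Type*} [CommRing A] [CommRing A'] (φ : A →+* A')
    (r : Matrix (Fin n) (Fin n) A) (ι : Fin n) : (prodL r ι).map φ = prodL (r.map φ) ι := by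
  rw [prodL, prodL]
  change φ.mapMatrix _ = _
  rw [map_list_prod, List.map_map]
  congr 2
  funext k
  ext α β
  by_cases h : α = β <;> simp [h]

theorem map_ringInverse {A A' : Type*} [CommRing A] [CommRing A'] (φ : A →+* A') {a : A}
    (ha : IsUnit a) : φ (Ring.inverse a) = Ring.inverse (φ a) := by
  refine (ha.map φ).mul_left_cancel ?_
  rw [Ring.mul_inverse_cancel _ (ha.map φ), ← map_mul, Ring.mul_inverse_cancel _ ha, map_one]

/-! ### Conjugation by upper triangular matrices over an arbitrary ring -/

section conj

variable {n : ℕ} {A : Type*} [CommRing A]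

/-- Taking the diagonal is multiplicative on upper triangular matrices, so the diagonal entries of
`g` and `h` are mutually inverse and cancel. -/
theorem diag_conj {g h : Matrix (Fin n) (Fin n) A} (hg : g.IsUpperTriangular)
    (hh : h.IsUpperTriangular) (hhg : h * g = 1) {r : Matrix (Fin n) (Fin n) A}
    (hr : r.IsUpperTriangular) (ι : Fin n) : (g * r * h) ι ι = r ι ι := by
  have h1 := isUpperTriangular_mul_apply_self hh hg ι
  rw [hhg, Matrix.one_apply_eq] at h1
  rw [isUpperTriangular_mul_apply_self (hg.mul hr) hh, isUpperTriangular_mul_apply_self hg hr,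
    mul_assoc, mul_comm (r ι ι), ← mul_assoc, mul_comm (g ι ι), ← h1, one_mul]

/-- The action of an invertible upper triangular matrix `g` with inverse `h` on points. -/
def RssPoint.conj (g h : Matrix (Fin n) (Fin n) A) (hg : g.IsUpperTriangular)
    (hh : h.IsUpperTriangular) (hhg : h * g = 1) (z : RssPoint n A) : RssPoint n A where
  r := g * z.r * h
  s := lowerPart (g * z.s * h)
  i := g *ᵥ z.i
  j := z.j ᵥ* h
  r_upper := (hg.mul z.r_upper).mul hh
  s_lower := lowerPart_isLowerTriangular _
  moment_eq_zero := by
    change lowerPart (g * z.r * h * lowerPart (g * z.s * h) - lowerPart (g * z.s * h) *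
      (g * z.r * h) + vecMulVec (g *ᵥ z.i) (z.j ᵥ* h)) = 0
    -- Passing to the lower part changes `g s h` by a strictly upper triangular matrix; its
    -- commutator with the upper triangular `g r h` is again strictly upper, so it dies in `𝔟*`.
    have key : g * z.r * h * lowerPart (g * z.s * h) - lowerPart (g * z.s * h) * (g * z.r * h)
        + vecMulVec (g *ᵥ z.i) (z.j ᵥ* h) =
        g * (z.r * z.s - z.s * z.r + vecMulVec z.i z.j) * h
        + (g * z.r * h * (lowerPart (g * z.s * h) - g * z.s * h)
          - (lowerPart (g * z.s * h) - g * z.s * h) * (g * z.r * h)) := by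
      have e1 : g * z.r * h * (g * z.s * h) = g * (z.r * z.s) * h := by
        calc g * z.r * h * (g * z.s * h) = g * z.r * (h * g) * (z.s * h) := by
              simp only [Matrix.mul_assoc]
          _ = _ := by rw [hhg]; simp only [Matrix.mul_assoc, Matrix.one_mul]
      have e2 : g * z.s * h * (g * z.r * h) = g * (z.s * z.r) * h := by
        calc g * z.s * h * (g * z.r * h) = g * z.s * (h * g) * (z.r * h) := by
              simp only [Matrix.mul_assoc]
          _ = _ := by rw [hhg]; simp only [Matrix.mul_assoc, Matrix.one_mul]
      have e3 : vecMulVec (g *ᵥ z.i) (z.j ᵥ* h) = g * vecMulVec z.i z.j * h := by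
        rw [Matrix.mul_vecMulVec, Matrix.vecMulVec_mul]
      rw [mul_sub, sub_mul, e1, e2, e3, mul_add, mul_sub, add_mul, sub_mul]
      abel
    have h0 : lowerPart (lowerPart (g * z.s * h) - g * z.s * h) = 0 := by
      rw [map_sub, lowerPart_lowerPart, sub_self]
    have hrU : (g * z.r * h).IsUpperTriangular := (hg.mul z.r_upper).mul hh
    rw [key, map_add, map_sub, lowerPart_mul_left hrU h0, lowerPart_mul_right hrU h0,
      lowerPart_mul_right hh (lowerPart_mul_left hg z.moment_eq_zero)]
    simp
  separable := separable_of_isUnit ((hg.mul z.r_upper).mul hh) fun ι γ hlt => by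
    rw [diag_conj hg hh hhg z.r_upper, diag_conj hg hh hhg z.r_upper]
    exact z.isUnit_sub hlt.ne'

theorem RssPoint.conj_conj {g h : Matrix (Fin n) (Fin n) A} (hg : g.IsUpperTriangular)
    (hh : h.IsUpperTriangular) (hhg : h * g = 1) (hgh : g * h = 1) (z : RssPoint n A) :
    (z.conj g h hg hh hhg).conj h g hh hg hgh = z := by
  refine RssPoint.ext' ?_
  ext1
  · change h * (g * z.r * h) * g = z.r
    rw [← Matrix.mul_assoc, ← Matrix.mul_assoc, hhg, Matrix.one_mul, Matrix.mul_assoc, hhg,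
      Matrix.mul_one]
  · change lowerPart (h * lowerPart (g * z.s * h) * g) = z.s
    rw [lowerPart_conj_lowerPart hh hg, ← Matrix.mul_assoc, ← Matrix.mul_assoc, hhg,
      Matrix.one_mul, Matrix.mul_assoc, hhg, Matrix.mul_one,
      lowerPart_of_isLowerTriangular z.s_lower]
  · change h *ᵥ (g *ᵥ z.i) = z.i
    rw [Matrix.mulVec_mulVec, hhg, Matrix.one_mulVec]
  · change (z.j ᵥ* h) ᵥ* g = z.j
    rw [Matrix.vecMul_vecMul, hhg, Matrix.vecMul_one]

theorem toGL_inv_mul [Algebra ℂ A] (b : Borel n) :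
    (Borel.toGL A b⁻¹).1 * (Borel.toGL A b).1 = 1 := by
  rw [← Units.val_mul, ← map_mul]; simp

theorem smul_eq_conj [Algebra ℂ A] (b : Borel n) (z : RssPoint n A) :
    b • z = z.conj (Borel.toGL A b).1 (Borel.toGL A b⁻¹).1 (Borel.toGL_upper A b)
      (Borel.toGL_upper A b⁻¹) (toGL_inv_mul b) := rfl

theorem RssPoint.conj_map {A' : Type*} [CommRing A'] (φ : A →+* A')
    {g h : Matrix (Fin n) (Fin n) A} (hg : g.IsUpperTriangular)
    (hh : h.IsUpperTriangular) (hhg : h * g = 1) {g' h' : Matrix (Fin n) (Fin n) A'}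
    (hg' : g'.IsUpperTriangular) (hh' : h'.IsUpperTriangular) (hhg' : h' * g' = 1)
    (e : g.map φ = g') (e' : h.map φ = h') (z : RssPoint n A) :
    (z.conj g h hg hh hhg).map φ = (z.map φ).conj g' h' hg' hh' hhg' := by
  subst e e'
  refine RssPoint.ext' ?_
  ext1
  · change (g * z.r * h).map φ = g.map φ * z.r.map φ * h.map φ
    rw [Matrix.map_mul, Matrix.map_mul]
  · change (lowerPart (g * z.s * h)).map φ = lowerPart (g.map φ * z.s.map φ * h.map φ)
    rw [← lowerPart_map, Matrix.map_mul, Matrix.map_mul]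
  · change φ ∘ (g *ᵥ z.i) = g.map φ *ᵥ (φ ∘ z.i)
    exact funext fun _ => RingHom.map_mulVec _ _ _ _
  · change φ ∘ (z.j ᵥ* h) = (φ ∘ z.j) ᵥ* h.map φ
    exact funext fun _ => RingHom.map_vecMul _ _ _ _

/-! ### The matrices `∏_{k ≠ ι} (r - r_{kk})` -/

theorem prodL_conj {g h r : Matrix (Fin n) (Fin n) A} (hg : g.IsUpperTriangular)
    (hh : h.IsUpperTriangular) (hhg : h * g = 1) (hr : r.IsUpperTriangular) (ι : Fin n) :
    prodL (g * r * h) ι = g * prodL r ι * h := by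
  have hgh : g * h = 1 := mul_eq_one_comm.1 hhg
  have key : ∀ l : List (Fin n),
      (l.map fun k => g * r * h - (g * r * h) k k • (1 : Matrix (Fin n) (Fin n) A)).prod =
        g * (l.map fun k => r - r k k • (1 : Matrix (Fin n) (Fin n) A)).prod * h := by
    intro l
    induction l with
    | nil => simp [hgh]
    | cons k l ih =>
      have e : g * r * h - (g * r * h) k k • (1 : Matrix (Fin n) (Fin n) A) =
          g * (r - r k k • (1 : Matrix (Fin n) (Fin n) A)) * h := by
        rw [diag_conj hg hh hhg hr, mul_sub, sub_mul]
        simp [hgh]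
      rw [List.map_cons, List.prod_cons, List.map_cons, List.prod_cons, ih, e]
      calc _ = g * (r - r k k • (1 : Matrix (Fin n) (Fin n) A)) * (h * g) *
            ((l.map fun k => r - r k k • (1 : Matrix (Fin n) (Fin n) A)).prod * h) := by
            simp only [Matrix.mul_assoc]
        _ = _ := by rw [hhg]; simp only [Matrix.mul_assoc, Matrix.one_mul]
  exact key _

theorem isUpperTriangular_sub_smul_one {r : Matrix (Fin n) (Fin n) A} (hr : r.IsUpperTriangular)
    (c : A) : (r - c • (1 : Matrix (Fin n) (Fin n) A)).IsUpperTriangular := by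
  intro i j hij
  have hij' : j < i := hij
  simp [hr hij, Matrix.one_apply_ne hij'.ne']

theorem isUpperTriangular_prodL {r : Matrix (Fin n) (Fin n) A} (hr : r.IsUpperTriangular)
    (ι : Fin n) : (prodL r ι).IsUpperTriangular := by
  rw [prodL]
  induction (List.finRange n).filter (fun k => k ≠ ι) with
  | nil => simpa using (Matrix.blockTriangular_one : (1 : Matrix (Fin n) (Fin n) A).BlockTriangular id)
  | cons k l ih =>
    rw [List.map_cons, List.prod_cons]
    exact (isUpperTriangular_sub_smul_one hr _).mul ih

theorem prodL_apply_self {r : Matrix (Fin n) (Fin n) A} (hr : r.IsUpperTriangular)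
    (ι α : Fin n) :
    prodL r ι α α = (((List.finRange n).filter (fun k => k ≠ ι)).map
      fun k => r α α - r k k).prod := by
  -- Triangularity is carried through the induction because multiplicativity of the diagonal depends
  -- on it.
  have key : ∀ l : List (Fin n),
      ((l.map fun k => r - r k k • (1 : Matrix (Fin n) (Fin n) A)).prod).IsUpperTriangular ∧
      (l.map fun k => r - r k k • (1 : Matrix (Fin n) (Fin n) A)).prod α α =
        (l.map fun k => r α α - r k k).prod := by
    intro l
    induction l with
    | nil => exact ⟨by simpa using (Matrix.blockTriangular_one :
        (1 : Matrix (Fin n) (Fin n) A).BlockTriangular id), by simp⟩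
    | cons k l ih =>
      rw [List.map_cons, List.prod_cons, List.map_cons, List.prod_cons]
      refine ⟨(isUpperTriangular_sub_smul_one hr _).mul ih.1, ?_⟩
      rw [isUpperTriangular_mul_apply_self (isUpperTriangular_sub_smul_one hr _) ih.1, ih.2]
      simp
  exact (key _).2

theorem prodL_apply_self_of_ne {r : Matrix (Fin n) (Fin n) A} (hr : r.IsUpperTriangular)
    {ι α : Fin n} (h : α ≠ ι) : prodL r ι α α = 0 := by
  rw [prodL_apply_self hr]
  refine List.prod_eq_zero (List.mem_map.2 ⟨α, ?_, sub_self _⟩)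
  simpa using h

theorem trace_prodL {r : Matrix (Fin n) (Fin n) A} (hr : r.IsUpperTriangular) (ι : Fin n) :
    (prodL r ι).trace = prodL r ι ι ι := by
  rw [Matrix.trace, Finset.sum_eq_single ι]
  · rfl
  · intro α _ h
    exact prodL_apply_self_of_ne hr h
  · simp

theorem isUnit_prodL_apply_self {r : Matrix (Fin n) (Fin n) A} (hr : r.IsUpperTriangular)
    (hu : ∀ ι γ, ι ≠ γ → IsUnit (r ι ι - r γ γ)) (ι : Fin n) : IsUnit (prodL r ι ι ι) := by
  rw [prodL_apply_self hr]
  have key : ∀ l : List (Fin n), (∀ k ∈ l, k ≠ ι) →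
      IsUnit (l.map fun k => r ι ι - r k k).prod := by
    intro l
    induction l with
    | nil => simp
    | cons k l ih =>
      intro hl
      rw [List.map_cons, List.prod_cons]
      exact (hu _ _ (hl k (by simp)).symm).mul (ih fun k hk => hl k (by simp [hk]))
  exact key _ fun k hk => by simpa using hk

theorem prodL_eq_aeval (r : Matrix (Fin n) (Fin n) A) (ι : Fin n) :
    prodL r ι = Polynomial.aeval r (((List.finRange n).filter (fun k => k ≠ ι)).map
      fun k => (Polynomial.X - Polynomial.C (r k k) : Polynomial A)).prod := by
  rw [prodL, map_list_prod, List.map_map]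
  congr 2
  funext k
  simp [Algebra.algebraMap_eq_smul_one]

theorem prodL_commute (r : Matrix (Fin n) (Fin n) A) (ι : Fin n) : Commute r (prodL r ι) := by
  rw [prodL_eq_aeval]
  conv_lhs => rw [← Polynomial.aeval_X (R := A) r]
  exact (Commute.all _ _).map (Polynomial.aeval r)

/-- Cayley–Hamilton: multiplying `∏_{k ≠ ι} (X - r_{kk})` by the missing factor gives the
characteristic polynomial. -/
theorem mul_prodL {r : Matrix (Fin n) (Fin n) A} (hr : r.IsUpperTriangular) (ι : Fin n) :
    r * prodL r ι = r ι ι • prodL r ι := by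
  have h := Matrix.aeval_self_charpoly r
  have e : (((List.finRange n).filter (fun k => k ≠ ι)).map
      fun k => (Polynomial.X - Polynomial.C (r k k) : Polynomial A)).prod =
      ∏ k ∈ Finset.univ.erase ι, (Polynomial.X - Polynomial.C (r k k)) := by
    rw [← List.prod_toFinset _ ((List.nodup_finRange n).filter _)]
    refine Finset.prod_congr ?_ fun _ _ => rfl
    ext k
    simp
  rw [Matrix.charpoly_of_isUpperTriangular _ hr, ← Finset.mul_prod_erase _ _ (Finset.mem_univ ι),
    map_mul, ← e, ← prodL_eq_aeval] at h
  rw [map_sub, Polynomial.aeval_X, Polynomial.aeval_C, Algebra.algebraMap_eq_smul_one, sub_mul,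
    smul_mul_assoc, one_mul] at h
  exact sub_eq_zero.1 h

/-- Left multiplication by `r` acts on the product both as `r_{ιι}` and, after commuting, as
`r_{γγ}`; their difference is a unit. -/
theorem prodL_mul_prodL {r : Matrix (Fin n) (Fin n) A} (hr : r.IsUpperTriangular) {ι γ : Fin n}
    (hu : IsUnit (r ι ι - r γ γ)) : prodL r ι * prodL r γ = 0 := by
  have h1 : r * (prodL r ι * prodL r γ) = r ι ι • (prodL r ι * prodL r γ) := by
    rw [← Matrix.mul_assoc, mul_prodL hr, smul_mul_assoc]
  have h2 : r * (prodL r ι * prodL r γ) = r γ γ • (prodL r ι * prodL r γ) := by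
    rw [← Matrix.mul_assoc, (prodL_commute r ι).eq, Matrix.mul_assoc, mul_prodL hr, mul_smul_comm]
  have h3 : (r ι ι - r γ γ) • (prodL r ι * prodL r γ) = 0 := by
    rw [sub_smul, ← h1, ← h2, sub_self]
  exact hu.smul_eq_zero.1 h3

/-! ### Diagonalisation by triangular matrices of eigenvectors -/

/-- The matrix whose columns are the eigenvectors of an upper triangular matrix `r`,
normalised to have `1` on the diagonal. -/
def eigenColumns (r : Matrix (Fin n) (Fin n) A) : Matrix (Fin n) (Fin n) A :=
  Matrix.of fun α ι => Ring.inverse (prodL r ι ι ι) * prodL r ι α ι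

/-- The matrix whose rows are the left eigenvectors of an upper triangular matrix `r`,
normalised to have `1` on the diagonal. -/
def eigenRows (r : Matrix (Fin n) (Fin n) A) : Matrix (Fin n) (Fin n) A :=
  Matrix.of fun ι α => Ring.inverse (prodL r ι ι ι) * prodL r ι ι α

theorem eigenColumns_upper {r : Matrix (Fin n) (Fin n) A} (hr : r.IsUpperTriangular) :
    (eigenColumns r).IsUpperTriangular := fun α ι h => by
  simp [eigenColumns, isUpperTriangular_prodL hr ι h]

theorem eigenRows_upper {r : Matrix (Fin n) (Fin n) A} (hr : r.IsUpperTriangular) :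
    (eigenRows r).IsUpperTriangular := fun α ι h => by
  simp [eigenRows, isUpperTriangular_prodL hr α h]

theorem eigenRows_mul_eigenColumns {r : Matrix (Fin n) (Fin n) A} (hr : r.IsUpperTriangular)
    (hu : ∀ ι γ, ι ≠ γ → IsUnit (r ι ι - r γ γ)) : eigenRows r * eigenColumns r = 1 := by
  ext ι γ
  -- Row `ι` of one product paired with column `γ` of the other is an entry of `prodL r ι * prodL r
  -- γ`.
  have e : (eigenRows r * eigenColumns r) ι γ = Ring.inverse (prodL r ι ι ι) *
      Ring.inverse (prodL r γ γ γ) * (prodL r ι * prodL r γ) ι γ := by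
    rw [Matrix.mul_apply, Matrix.mul_apply, Finset.mul_sum]
    refine Finset.sum_congr rfl fun k _ => ?_
    simp only [eigenRows, eigenColumns, Matrix.of_apply]
    ring
  rw [e]
  by_cases h : ι = γ
  · subst h
    have hc := Ring.inverse_mul_cancel _ (isUnit_prodL_apply_self hr hu ι)
    rw [isUpperTriangular_mul_apply_self (isUpperTriangular_prodL hr _)
      (isUpperTriangular_prodL hr _), Matrix.one_apply_eq, mul_mul_mul_comm, hc, one_mul]
  · rw [prodL_mul_prodL hr (hu _ _ h), Matrix.one_apply_ne h]
    simp

theorem mul_eigenColumns {r : Matrix (Fin n) (Fin n) A} (hr : r.IsUpperTriangular) :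
    r * eigenColumns r = eigenColumns r * Matrix.diagonal fun ι => r ι ι := by
  ext α ι
  rw [Matrix.mul_diagonal, Matrix.mul_apply]
  have h := congrFun (congrFun (mul_prodL hr ι) α) ι
  rw [Matrix.mul_apply, Matrix.smul_apply, smul_eq_mul] at h
  simp only [eigenColumns, Matrix.of_apply]
  rw [mul_assoc, mul_comm (prodL r ι α ι), ← h, Finset.mul_sum]
  exact Finset.sum_congr rfl fun _ _ => by ring

theorem eigenColumns_map {A' : Type*} [CommRing A'] (φ : A →+* A')
    {r : Matrix (Fin n) (Fin n) A} (hr : r.IsUpperTriangular)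
    (hu : ∀ ι γ, ι ≠ γ → IsUnit (r ι ι - r γ γ)) :
    (eigenColumns r).map φ = eigenColumns (r.map φ) := by
  ext α ι
  have := isUnit_prodL_apply_self hr hu ι
  simp [eigenColumns, ← prodL_map, map_ringInverse φ this]

theorem eigenRows_map {A' : Type*} [CommRing A'] (φ : A →+* A')
    {r : Matrix (Fin n) (Fin n) A} (hr : r.IsUpperTriangular)
    (hu : ∀ ι γ, ι ≠ γ → IsUnit (r ι ι - r γ γ)) :
    (eigenRows r).map φ = eigenRows (r.map φ) := by
  ext α ι
  have := isUnit_prodL_apply_self hr hu α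
  simp [eigenRows, ← prodL_map, map_ringInverse φ this]

/-! ### Invariance of `s'` -/

theorem RssPoint.conj_diag {g h : Matrix (Fin n) (Fin n) A} (hg : g.IsUpperTriangular)
    (hh : h.IsUpperTriangular) (hhg : h * g = 1) (z : RssPoint n A) (ι : Fin n) :
    (z.conj g h hg hh hhg).r ι ι = z.r ι ι :=
  diag_conj hg hh hhg z.r_upper ι

/-- Upper times strictly upper triangular has zero diagonal. This is why `s'` depends only on the
class of `s` in `𝔟*`. -/
theorem trace_mul_lowerPart {L M : Matrix (Fin n) (Fin n) A} (hL : L.IsUpperTriangular) :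
    (L * lowerPart M).trace = (L * M).trace := by
  rw [← sub_eq_zero, ← Matrix.trace_sub, ← mul_sub]
  refine Finset.sum_eq_zero fun ι _ => ?_
  have h0 : lowerPart (L * (lowerPart M - M)) = 0 :=
    lowerPart_mul_left hL (by rw [map_sub, lowerPart_lowerPart, sub_self])
  exact (lowerPart_eq_zero_iff _).1 h0 ι ι le_rfl

theorem RssPoint.conj_sPrime {g h : Matrix (Fin n) (Fin n) A} (hg : g.IsUpperTriangular)
    (hh : h.IsUpperTriangular) (hhg : h * g = 1) (z : RssPoint n A) (ι : Fin n) :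
    (z.conj g h hg hh hhg).sPrime ι = z.sPrime ι := by
  change Ring.inverse (prodL (g * z.r * h) ι).trace *
    (prodL (g * z.r * h) ι * lowerPart (g * z.s * h)).trace = _
  rw [trace_mul_lowerPart (isUpperTriangular_prodL ((hg.mul z.r_upper).mul hh) ι),
    prodL_conj hg hh hhg z.r_upper]
  have e : ∀ M : Matrix (Fin n) (Fin n) A, (g * M * h).trace = M.trace := fun M => by
    rw [Matrix.trace_mul_comm, ← Matrix.mul_assoc, hhg, Matrix.one_mul]
  have e' : g * prodL z.r ι * h * (g * z.s * h) = g * (prodL z.r ι * z.s) * h := by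
    calc _ = g * prodL z.r ι * (h * g) * (z.s * h) := by simp only [Matrix.mul_assoc]
      _ = _ := by rw [hhg]; simp only [Matrix.mul_assoc, Matrix.one_mul]
  rw [e', e, e]
  rfl

theorem RssPoint.isUnit_trace_prodL (z : RssPoint n A) (ι : Fin n) :
    IsUnit (prodL z.r ι).trace := by
  rw [trace_prodL z.r_upper]
  exact isUnit_prodL_apply_self z.r_upper (fun _ _ h => z.isUnit_sub h) ι

theorem RssPoint.sPrime_map {A' : Type*} [CommRing A'] (φ : A →+* A') (z : RssPoint n A)
    (ι : Fin n) : (z.map φ).sPrime ι = φ (z.sPrime ι) := by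
  change Ring.inverse (prodL (z.r.map φ) ι).trace * (prodL (z.r.map φ) ι * z.s.map φ).trace = _
  have ht : ∀ M : Matrix (Fin n) (Fin n) A, (M.map φ).trace = φ M.trace := fun M => by
    simp [Matrix.trace]
  rw [← prodL_map, ← Matrix.map_mul, ht, ht, ← map_ringInverse φ (z.isUnit_trace_prodL ι),
    ← map_mul]
  rfl

theorem RssPoint.sPrime_of_diagonal (z : RssPoint n A) {d : Fin n → A}
    (hz : z.r = Matrix.diagonal d) (ι : Fin n) : z.sPrime ι = z.s ι ι := by
  -- For diagonal `r` the product is diagonal, and only its entry at `ι` survives, so the trace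
  -- picks out `s_{ιι}`.
  have hp : prodL z.r ι = Matrix.diagonal fun α => prodL z.r ι α α := by
    have : ∀ l : List (Fin n), ∃ c : Fin n → A,
        (l.map fun k => z.r - z.r k k • (1 : Matrix (Fin n) (Fin n) A)).prod =
          Matrix.diagonal c := by
      intro l
      induction l with
      | nil => exact ⟨fun _ => 1, by simp⟩
      | cons k l ih =>
        obtain ⟨c, hc⟩ := ih
        refine ⟨fun α => (d α - z.r k k) * c α, ?_⟩
        rw [List.map_cons, List.prod_cons, hc, hz, ← Matrix.diagonal_mul_diagonal]
        congr 1
        ext α β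
        by_cases h : α = β <;> simp [h]
    obtain ⟨c, hc⟩ := this ((List.finRange n).filter (fun k => k ≠ ι))
    change prodL z.r ι = _ at hc
    rw [hc]
    simp
  have ht : (prodL z.r ι * z.s).trace = prodL z.r ι ι ι * z.s ι ι := by
    rw [Matrix.trace, Finset.sum_eq_single ι]
    · rw [hp]
      simp
    · intro α _ h
      rw [hp]
      simp [prodL_apply_self_of_ne z.r_upper h]
    · simp
  rw [CotangentPoint.sPrime, ht, ← trace_prodL z.r_upper, ← mul_assoc,
    Ring.inverse_mul_cancel _ (z.isUnit_trace_prodL ι), one_mul]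

end conj

/-! ### The diagonal slice and the normal form of a point -/

section slice

variable {n : ℕ} {A : Type*} [CommRing A]

theorem diagonal_moment_apply {z : CotangentPoint n A} {d : Fin n → A}
    (hz : z.r = Matrix.diagonal d) {ι γ : Fin n} (h : γ ≤ ι) :
    z.moment ι γ = (d ι - d γ) * z.s ι γ + z.i ι * z.j γ := by
  rw [CotangentPoint.moment, lowerPart_apply, if_pos h, hz]
  simp only [Matrix.add_apply, Matrix.sub_apply, Matrix.diagonal_mul, Matrix.mul_diagonal,
    vecMulVec_apply]
  ring

/-- For `γ < ι` the coefficient is a unit and this solves for `s_{ιγ}`; for `γ = ι` it says `x_ι y_ι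
= 0`. -/
theorem RssPoint.diagonal_moment {z : RssPoint n A} {d : Fin n → A}
    (hz : z.r = Matrix.diagonal d) {ι γ : Fin n} (h : γ ≤ ι) :
    (d ι - d γ) * z.s ι γ + z.i ι * z.j γ = 0 := by
  rw [← diagonal_moment_apply hz h, z.moment_eq_zero, Matrix.zero_apply]

theorem RssPoint.i_mul_j_of_diagonal {z : RssPoint n A} {d : Fin n → A}
    (hz : z.r = Matrix.diagonal d) (ι : Fin n) : z.i ι * z.j ι = 0 := by
  simpa using z.diagonal_moment hz (le_refl ι)

/-- A point with diagonal `r` is determined by `r`, `i`, `j` and the diagonal of `s`. -/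
theorem RssPoint.ext_of_diagonal {z w : RssPoint n A} {d : Fin n → A}
    (hz : z.r = Matrix.diagonal d) (hw : w.r = Matrix.diagonal d)
    (hs : ∀ ι, z.s ι ι = w.s ι ι) (hi : z.i = w.i) (hj : z.j = w.j) : z = w := by
  refine RssPoint.ext' (CotangentPoint.ext (hz.trans hw.symm) ?_ hi hj)
  ext ι γ
  rcases lt_trichotomy γ ι with h | rfl | h
  · have h1 := z.diagonal_moment hz h.le
    have h2 := w.diagonal_moment hw h.le
    rw [hi, hj, ← h2, add_left_inj] at h1
    have hu := z.isUnit_sub h.ne'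
    rw [hz, Matrix.diagonal_apply_eq, Matrix.diagonal_apply_eq] at hu
    exact hu.mul_left_cancel h1
  · exact hs _
  · rw [z.s_lower (OrderDual.toDual_lt_toDual.2 h), w.s_lower (OrderDual.toDual_lt_toDual.2 h)]

/-- The point with `r` diagonal and prescribed `i`, `j` and diagonal of `s`. -/
def slice (d σ x y : Fin n → A) (hu : ∀ ι γ, ι ≠ γ → IsUnit (d ι - d γ))
    (hxy : ∀ ι, x ι * y ι = 0) : RssPoint n A where
  r := Matrix.diagonal d
  s := Matrix.of fun ι γ => if γ = ι then σ ι else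
    if γ < ι then -(Ring.inverse (d ι - d γ) * (x ι * y γ)) else 0
  i := x
  j := y
  r_upper ι γ h := by
    have h' : γ < ι := h
    simp [h'.ne']
  s_lower ι γ h := by
    have h' : ι < γ := h
    simp [h'.ne', h'.not_gt]
  moment_eq_zero := by
    rw [CotangentPoint.moment, lowerPart_eq_zero_iff]
    intro ι γ h
    simp only [Matrix.add_apply, Matrix.sub_apply, Matrix.diagonal_mul, Matrix.mul_diagonal,
      vecMulVec_apply, Matrix.of_apply]
    rcases eq_or_lt_of_le h with rfl | h
    · simp [hxy, mul_comm]
    · have e := Ring.mul_inverse_cancel _ (hu _ _ h.ne')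
      rw [if_neg h.ne, if_pos h]
      linear_combination (-(x ι * y γ)) * e
  separable := separable_of_isUnit
    (fun ι γ h => by
      have h' : γ < ι := h
      simp [h'.ne'])
    fun ι γ h => by simpa using hu _ _ h.ne'

variable {A' : Type*} [CommRing A']

theorem slice_r (d σ x y : Fin n → A) (hu : ∀ ι γ, ι ≠ γ → IsUnit (d ι - d γ))
    (hxy : ∀ ι, x ι * y ι = 0) : (slice d σ x y hu hxy).r = Matrix.diagonal d := rfl

theorem slice_s_self (d σ x y : Fin n → A) (hu : ∀ ι γ, ι ≠ γ → IsUnit (d ι - d γ))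
    (hxy : ∀ ι, x ι * y ι = 0) (ι : Fin n) : (slice d σ x y hu hxy).s ι ι = σ ι := by
  simp [slice]

theorem slice_sPrime (d σ x y : Fin n → A) (hu : ∀ ι γ, ι ≠ γ → IsUnit (d ι - d γ))
    (hxy : ∀ ι, x ι * y ι = 0) (ι : Fin n) : (slice d σ x y hu hxy).sPrime ι = σ ι := by
  rw [RssPoint.sPrime_of_diagonal _ (slice_r d σ x y hu hxy), slice_s_self]

theorem map_diagonal_r (φ : A →+* A') {z : RssPoint n A} {d : Fin n → A}
    (hz : z.r = Matrix.diagonal d) : (z.map φ).r = Matrix.diagonal fun ι => φ (d ι) := by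
  change z.r.map φ = _
  rw [hz, Matrix.diagonal_map (map_zero φ)]

theorem slice_map (φ : A →+* A') {d σ x y : Fin n → A} {d' σ' x' y' : Fin n → A'}
    (hu : ∀ ι γ, ι ≠ γ → IsUnit (d ι - d γ)) (hxy : ∀ ι, x ι * y ι = 0)
    (hu' : ∀ ι γ, ι ≠ γ → IsUnit (d' ι - d' γ)) (hxy' : ∀ ι, x' ι * y' ι = 0)
    (hd : ∀ ι, φ (d ι) = d' ι) (hσ : ∀ ι, φ (σ ι) = σ' ι) (hx : ∀ ι, φ (x ι) = x' ι)
    (hy : ∀ ι, φ (y ι) = y' ι) :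
    (slice d σ x y hu hxy).map φ = slice d' σ' x' y' hu' hxy' := by
  refine RssPoint.ext_of_diagonal (map_diagonal_r φ (slice_r ..))
    ((slice_r ..).trans ?_) (fun ι => ?_) (funext hx) (funext hy)
  · congr 1; exact (funext hd).symm
  · rw [slice_s_self, ← hσ]
    exact congrArg φ (slice_s_self ..)

/-! ### Normal forms -/

/-- The point of the diagonal slice to which `z` is conjugate. -/
def RssPoint.toSlice (z : RssPoint n A) : RssPoint n A :=
  z.conj (eigenRows z.r) (eigenColumns z.r) (eigenRows_upper z.r_upper)
    (eigenColumns_upper z.r_upper)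
    (mul_eq_one_comm.1 (eigenRows_mul_eigenColumns z.r_upper fun _ _ h => z.isUnit_sub h))

theorem RssPoint.toSlice_r (z : RssPoint n A) :
    z.toSlice.r = Matrix.diagonal fun ι => z.r ι ι := by
  change eigenRows z.r * z.r * eigenColumns z.r = _
  rw [Matrix.mul_assoc, mul_eigenColumns z.r_upper, ← Matrix.mul_assoc,
    eigenRows_mul_eigenColumns z.r_upper fun _ _ h => z.isUnit_sub h, Matrix.one_mul]

/-- The point with a given `r` whose conjugate in the diagonal slice has prescribed `i`, `j` and
diagonal of `s`. -/
def ofNormalForm (p : CotangentPoint n A) (hu : ∀ ι γ, ι ≠ γ → IsUnit (p.r ι ι - p.r γ γ))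
    (hxy : ∀ ι, p.i ι * p.j ι = 0) : RssPoint n A :=
  (slice (fun ι => p.r ι ι) (fun ι => p.s ι ι) p.i p.j hu hxy).conj (eigenColumns p.r)
    (eigenRows p.r) (eigenColumns_upper p.r_upper) (eigenRows_upper p.r_upper)
    (eigenRows_mul_eigenColumns p.r_upper hu)

/-- The eigenvector matrices and the slice are built from ring operations and inverses of units, all
preserved by `φ`. -/
theorem ofNormalForm_map (φ : A →+* A') (p : CotangentPoint n A)
    (hu : ∀ ι γ, ι ≠ γ → IsUnit (p.r ι ι - p.r γ γ)) (hxy : ∀ ι, p.i ι * p.j ι = 0)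
    {q : CotangentPoint n A'} (hu' : ∀ ι γ, ι ≠ γ → IsUnit (q.r ι ι - q.r γ γ))
    (hxy' : ∀ ι, q.i ι * q.j ι = 0) (hq : p.map φ = q) :
    (ofNormalForm p hu hxy).map φ = ofNormalForm q hu' hxy' := by
  subst hq
  rw [ofNormalForm, RssPoint.conj_map φ _ _ _ _ _ _ (eigenColumns_map φ p.r_upper hu)
    (eigenRows_map φ p.r_upper hu), slice_map φ hu hxy hu' hxy' (fun _ => rfl) (fun _ => rfl)
    (fun _ => rfl) (fun _ => rfl)]
  rfl

/-- The matrix `r` of a point together with `i`, `j` and `s` of its conjugate in the slice. -/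
def RssPoint.normalForm (z : RssPoint n A) : CotangentPoint n A where
  r := z.r
  s := z.toSlice.s
  i := z.toSlice.i
  j := z.toSlice.j
  r_upper := z.r_upper
  s_lower := z.toSlice.s_lower

/-- The slice point is recovered from its diagonal data, and conjugating back undoes `toSlice`. -/
theorem RssPoint.ofNormalForm_normalForm (z : RssPoint n A) :
    ofNormalForm z.normalForm (fun _ _ h => z.isUnit_sub h)
      (z.toSlice.i_mul_j_of_diagonal z.toSlice_r) = z := by
  have hu : ∀ ι γ, ι ≠ γ → IsUnit (z.r ι ι - z.r γ γ) := fun _ _ h => z.isUnit_sub h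
  have hVU := eigenRows_mul_eigenColumns z.r_upper hu
  have e : slice (fun ι => z.r ι ι) (fun ι => z.toSlice.s ι ι) z.toSlice.i z.toSlice.j hu
      (z.toSlice.i_mul_j_of_diagonal z.toSlice_r) = z.toSlice :=
    RssPoint.ext_of_diagonal (slice_r ..) z.toSlice_r (fun _ => slice_s_self ..) rfl rfl
  change (slice (fun ι => z.r ι ι) (fun ι => z.toSlice.s ι ι) z.toSlice.i z.toSlice.j _ _).conj
    (eigenColumns z.r) (eigenRows z.r) _ _ _ = z
  rw [e]
  exact z.conj_conj (eigenRows_upper z.r_upper) (eigenColumns_upper z.r_upper)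
    (mul_eq_one_comm.1 hVU) hVU

end slice

/-! ### The coordinate ring is reduced -/

/-- Let a monomial `m` of `f` lie outside the ideal. It misses a variable of every generator, so
setting to zero all variables not in `m` kills the ideal and hence `f ^ k`. The target is a domain,
so `f` itself dies, which puts a variable absent from `m` among the divisors of `m`. -/
theorem isRadical_span_X_mul_X {τ σ K : Type*} [Field K] (a b : τ → σ) (hab : ∀ i, a i ≠ b i) :
    (Ideal.span (Set.range fun i => (MvPolynomial.X (a i) * MvPolynomial.X (b i) :
      MvPolynomial σ K))).IsRadical := by
  classical
  have hJ : Ideal.span (Set.range fun i => (MvPolynomial.X (a i) * MvPolynomial.X (b i) :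
      MvPolynomial σ K)) = Ideal.span ((fun m => MvPolynomial.monomial m (1 : K)) ''
        Set.range fun i => Finsupp.single (a i) 1 + Finsupp.single (b i) 1) := by
    rw [← Set.range_comp]
    congr 2
    funext i
    simp [MvPolynomial.X, MvPolynomial.monomial_mul]
  rintro f ⟨k, hk⟩
  rw [hJ, MvPolynomial.mem_ideal_span_monomial_image]
  intro m hm
  by_contra hcon
  have hZ : ∀ i, m (a i) = 0 ∨ m (b i) = 0 := by
    intro i
    by_contra! h
    refine hcon ⟨_, ⟨i, rfl⟩, fun v => ?_⟩
    simp only [Finsupp.add_apply, Finsupp.single_apply]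
    have := hab i
    -- The generator divides `m` only because `a i ≠ b i` keeps its exponents at most one.
    split_ifs with h1 h2 h2
    · exact absurd (h1.trans h2.symm) this
    · subst h1; omega
    · subst h2; omega
    · omega
  let I : Ideal (MvPolynomial σ K) := Ideal.span (MvPolynomial.X '' {v | m v = 0})
  let ρ : MvPolynomial σ K →ₐ[K] MvPolynomial σ K :=
    MvPolynomial.aeval fun v => if m v = 0 then 0 else MvPolynomial.X v
  have hρ : f - ρ f ∈ I := by
    rw [← Ideal.Quotient.eq]
    have : Ideal.Quotient.mkₐ K I = (Ideal.Quotient.mkₐ K I).comp ρ := by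
      refine MvPolynomial.algHom_ext fun v => ?_
      by_cases hv : m v = 0
      · have : (MvPolynomial.X v : MvPolynomial σ K) ∈ I := Ideal.subset_span ⟨v, hv, rfl⟩
        simp [ρ, hv, Ideal.Quotient.eq_zero_iff_mem.2 this]
      · simp [ρ, hv]
    exact congrArg (fun g : MvPolynomial σ K →ₐ[K] _ => g f) this
  have hker : Ideal.span (Set.range fun i => (MvPolynomial.X (a i) * MvPolynomial.X (b i) :
      MvPolynomial σ K)) ≤ RingHom.ker ρ := by
    rw [Ideal.span_le]
    rintro _ ⟨i, rfl⟩
    change ρ _ = 0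
    rcases hZ i with h | h <;> simp [ρ, h]
  have hf : ρ f = 0 := by
    have : ρ (f ^ k) = 0 := hker hk
    rw [map_pow] at this
    exact eq_zero_of_pow_eq_zero this
  rw [hf, sub_zero] at hρ
  obtain ⟨v, hv, hv'⟩ := MvPolynomial.mem_ideal_span_X_image.1 hρ m hm
  exact hv' hv

/-! ### Embedding the coordinate ring in the ring of normal forms -/

/-- The ideal of relations `x_k y_k = 0` in the coordinates of a normal form. -/
def normalIdeal (n : ℕ) : Ideal (CotangentRing n) :=
  Ideal.span (Set.range fun k : Fin n => MvPolynomial.X (.x k) * MvPolynomial.X (.y k))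

/-- The ring of functions of a normal form. -/
abbrev NormalRing (n : ℕ) : Type :=
  Localization.Away (Ideal.Quotient.mk (normalIdeal n) (discr n))

instance (n : ℕ) : IsReduced (CotangentRing n ⧸ normalIdeal n) :=
  (Ideal.isRadical_iff_quotient_reduced _).1
    (isRadical_span_X_mul_X _ _ fun _ h => nomatch h)

/-- The structure map from polynomials to functions of a normal form. -/
def toNormalRing (n : ℕ) : CotangentRing n →ₐ[ℂ] NormalRing n :=
  (IsScalarTower.toAlgHom ℂ (CotangentRing n ⧸ normalIdeal n) (NormalRing n)).comp
    (Ideal.Quotient.mkₐ ℂ (normalIdeal n))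

theorem toNormalRing_x_mul_y (n : ℕ) (k : Fin n) :
    toNormalRing n (MvPolynomial.X (.x k)) * toNormalRing n (MvPolynomial.X (.y k)) = 0 := by
  rw [← map_mul, toNormalRing, AlgHom.comp_apply]
  have : Ideal.Quotient.mkₐ ℂ (normalIdeal n)
      (MvPolynomial.X (.x k) * MvPolynomial.X (.y k)) = 0 :=
    Ideal.Quotient.eq_zero_iff_mem.2 (Ideal.subset_span ⟨k, rfl⟩)
  rw [this, map_zero]

theorem isUnit_sub_of_isUnit_prodDiff {n : ℕ} {A : Type*} [CommRing A] {d : Fin n → A}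
    (h : IsUnit (prodDiff d)) (ι γ : Fin n) (hne : ι ≠ γ) : IsUnit (d ι - d γ) := by
  rcases lt_or_gt_of_ne hne with hlt | hlt
  · have := (isUnit_prodDiff.1 h _ _ hlt).neg
    rwa [neg_sub] at this
  · exact isUnit_prodDiff.1 h _ _ hlt

theorem toNormalRing_isUnit_sub (n : ℕ) (ι γ : Fin n) (h : ι ≠ γ) :
    IsUnit (toNormalRing n ((genericPoint n).r ι ι) - toNormalRing n ((genericPoint n).r γ γ)) := by
  refine isUnit_sub_of_isUnit_prodDiff (d := fun ι => toNormalRing n ((genericPoint n).r ι ι)) ?_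
    ι γ h
  have e := map_prodDiff (toNormalRing n : CotangentRing n →+* NormalRing n)
    fun ι => (genericPoint n).r ι ι
  refine e ▸ ?_
  exact IsLocalization.Away.algebraMap_isUnit (S := NormalRing n)
    (Ideal.Quotient.mk (normalIdeal n) (discr n))

/-- The tautological point over the ring of functions of a normal form. -/
def normalPoint (n : ℕ) : RssPoint n (NormalRing n) :=
  ofNormalForm ((genericPoint n).map (toNormalRing n : CotangentRing n →+* NormalRing n))
    (toNormalRing_isUnit_sub n) (toNormalRing_x_mul_y n)

theorem exists_normalRing_hom (n : ℕ) {A : Type*} [CommRing A] [Algebra ℂ A]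
    (p : CotangentPoint n A) (hu : ∀ ι γ, ι ≠ γ → IsUnit (p.r ι ι - p.r γ γ))
    (hxy : ∀ ι, p.i ι * p.j ι = 0) :
    ∃ φ : NormalRing n →ₐ[ℂ] A, φ.comp (toNormalRing n) = MvPolynomial.aeval p.coord := by
  have hJ : ∀ a ∈ normalIdeal n, MvPolynomial.aeval (R := ℂ) p.coord a = 0 := by
    have : normalIdeal n ≤ RingHom.ker (MvPolynomial.aeval (R := ℂ) p.coord) := by
      rw [normalIdeal, Ideal.span_le]
      rintro _ ⟨k, rfl⟩
      change MvPolynomial.aeval (R := ℂ) p.coord _ = 0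
      simpa [CotangentPoint.coord] using hxy k
    exact this
  have hD : IsUnit (MvPolynomial.aeval (R := ℂ) p.coord (discr n)) := by
    have e := map_prodDiff (MvPolynomial.aeval (R := ℂ) p.coord : CotangentRing n →+* A)
      fun ι => (genericPoint n).r ι ι
    refine e ▸ isUnit_prodDiff.2 fun ι γ h => ?_
    have hr : ∀ ι, MvPolynomial.aeval (R := ℂ) p.coord ((genericPoint n).r ι ι) = p.r ι ι :=
      fun ι => congrFun (congrFun (congrArg CotangentPoint.r (genericPoint_map_aeval p)) ι) ι
    change IsUnit (MvPolynomial.aeval (R := ℂ) p.coord _ - MvPolynomial.aeval (R := ℂ) p.coord _)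
    rw [hr, hr]
    exact hu _ _ h.ne'
  refine ⟨IsLocalization.liftAlgHom
    (M := Submonoid.powers (Ideal.Quotient.mk (normalIdeal n) (discr n))) (S := NormalRing n)
    (f := Ideal.Quotient.liftₐ (normalIdeal n) (MvPolynomial.aeval (R := ℂ) p.coord) hJ) ?_, ?_⟩
  · rintro ⟨_, k, rfl⟩
    simp only [map_pow]
    exact hD.pow k
  · refine MvPolynomial.algHom_ext fun c => ?_
    exact (IsLocalization.lift_eq _ _)

/-- The normal form of the tautological point defines a map `φ` back. It carries `normalPoint` to
`univPoint`, so it is a left inverse. The coordinates of `s` below the diagonal are idle extra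
variables here: only an embedding is needed. -/
theorem evalAt_normalPoint_injective (n : ℕ) : Function.Injective (evalAt (normalPoint n)) := by
  obtain ⟨φ, hφ⟩ := exists_normalRing_hom n (univPoint n).normalForm
    (fun _ _ h => (univPoint n).isUnit_sub h)
    ((univPoint n).toSlice.i_mul_j_of_diagonal (univPoint n).toSlice_r)
  have h1 : (normalPoint n).map (φ : NormalRing n →+* RssRing n) = univPoint n := by
    refine (ofNormalForm_map (φ : NormalRing n →+* RssRing n) _ _ _ _ _ ?_).trans
      (univPoint n).ofNormalForm_normalForm
    · rw [CotangentPoint.map_map]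
      have : (φ : NormalRing n →+* RssRing n).comp
          (toNormalRing n : CotangentRing n →+* NormalRing n) =
          (MvPolynomial.aeval (R := ℂ) (univPoint n).normalForm.coord).toRingHom :=
        congrArg (fun g : CotangentRing n →ₐ[ℂ] RssRing n => (g : CotangentRing n →+* RssRing n)) hφ
      rw [this, genericPoint_map_aeval]
  refine Function.LeftInverse.injective (g := φ) fun f => ?_
  rw [← evalAt_map_apply, h1, evalAt_univPoint, AlgHom.id_apply]

instance (n : ℕ) : IsReduced (RssRing n) :=
  isReduced_of_injective (evalAt (normalPoint n)) (evalAt_normalPoint_injective n)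

/-! ### Closed points separate functions -/

instance (n : ℕ) : Finite (Coord n) := by
  let f : Coord n → Fin 4 × Fin n × Fin n
    | .r ι γ _ => (0, ι, γ)
    | .s ι γ _ => (1, ι, γ)
    | .x k => (2, k, k)
    | .y k => (3, k, k)
  refine Finite.of_injective f fun a b h => ?_
  cases a <;> cases b <;> simp_all [f]

/-- Nullstellensatz: in a reduced Jacobson ring some maximal ideal avoids `f`, and its residue field
is finite over `ℂ`, hence maps to `ℂ`. -/
theorem exists_algHom_ne_zero {A : Type*} [CommRing A] [Algebra ℂ A] [Algebra.FiniteType ℂ A]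
    [IsReduced A] {f : A} (hf : f ≠ 0) : ∃ φ : A →ₐ[ℂ] ℂ, φ f ≠ 0 := by
  have : IsJacobsonRing A := isJacobsonRing_of_finiteType (A := ℂ)
  have hj : (⊥ : Ideal A).jacobson = ⊥ := by
    refine IsJacobsonRing.out' _ ?_
    rw [Ideal.isRadical_iff_quotient_reduced]
    exact isReduced_of_injective (RingEquiv.quotientBot A) (RingEquiv.injective _)
  have hf' : f ∉ (⊥ : Ideal A).jacobson := by rwa [hj]
  rw [Ideal.jacobson, Submodule.mem_sInf] at hf'
  push Not at hf'
  obtain ⟨M, ⟨-, hM⟩, hfM⟩ := hf'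
  let _ : Field (A ⧸ M) := Ideal.Quotient.field M
  have : Module.Finite ℂ (A ⧸ M) := finite_of_finite_type_of_isJacobsonRing ℂ (A ⧸ M)
  let ψ : (A ⧸ M) →ₐ[ℂ] ℂ := IsAlgClosed.lift
  refine ⟨ψ.comp (Ideal.Quotient.mkₐ ℂ M), fun h => hfM ?_⟩
  exact Ideal.Quotient.eq_zero_iff_mem.1 ((map_eq_zero ψ).1 h)

instance (n : ℕ) : Algebra.FiniteType ℂ (RssRing n) := by
  have : Algebra.FiniteType (CotangentRing n) (CotangentRssRing n) :=
    IsLocalization.finiteType_of_monoid_fg (Submonoid.powers (discr n)) _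
  have : Algebra.FiniteType ℂ (CotangentRssRing n) := .trans (S := CotangentRing n) inferInstance this
  exact .of_surjective (Ideal.Quotient.mkₐ ℂ (momentIdeal n)) Ideal.Quotient.mk_surjective

/-- A function vanishing at all closed points of `μ⁻¹(0)^{rss}` is zero. -/
theorem eq_of_evalAt_eq {n : ℕ} {f g : RssRing n}
    (h : ∀ z : RssPoint n ℂ, evalAt z f = evalAt z g) : f = g := by
  by_contra hne
  obtain ⟨φ, hφ⟩ := exists_algHom_ne_zero (sub_ne_zero.2 hne)
  refine hφ ?_
  rw [← evalAt_univPoint_map φ, map_sub, h, sub_self]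

/-! ### Zariski topologies induced by coordinates -/

theorem mem_closure_induced_pointToPoint {X σ : Type*} [t : TopologicalSpace X] (c : X → σ → ℂ)
    (ht : t = TopologicalSpace.induced
      (fun z => (MvPolynomial.pointToPoint (k := ℂ) (c z) : PrimeSpectrum (MvPolynomial σ ℂ)))
      inferInstance) (S : Set X) (z : X) :
    z ∈ closure S ↔ ∀ f : MvPolynomial σ ℂ,
      (∀ w ∈ S, MvPolynomial.aeval (c w) f = 0) → MvPolynomial.aeval (c z) f = 0 := by
  have hind : Topology.IsInducing
      (fun z => (MvPolynomial.pointToPoint (k := ℂ) (c z) : PrimeSpectrum (MvPolynomial σ ℂ))) :=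
    ⟨ht⟩
  rw [hind.closure_eq_preimage_closure_image, Set.mem_preimage,
    ← PrimeSpectrum.zeroLocus_vanishingIdeal_eq_closure, ← Set.image_image
      (fun x : σ → ℂ => (MvPolynomial.pointToPoint (k := ℂ) x : PrimeSpectrum (MvPolynomial σ ℂ))),
    MvPolynomial.vanishingIdeal_pointToPoint, PrimeSpectrum.mem_zeroLocus]
  constructor
  · intro h f hf
    refine (MvPolynomial.mem_vanishingIdeal_singleton_iff _ _).1 (h ?_)
    rintro _ ⟨w, hw, rfl⟩
    exact hf w hw
  · intro h f hf
    exact (MvPolynomial.mem_vanishingIdeal_singleton_iff _ _).2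
      (h f fun w hw => hf _ ⟨w, hw, rfl⟩)

/-- Only zero sets have to be matched, not values; this leaves room for clearing denominators in
`h`. -/
theorem continuous_of_pointToPoint {X Y σ τ : Type*} [t : TopologicalSpace X]
    [u : TopologicalSpace Y] (c : X → σ → ℂ) (d : Y → τ → ℂ)
    (ht : t = TopologicalSpace.induced
      (fun z => (MvPolynomial.pointToPoint (k := ℂ) (c z) : PrimeSpectrum (MvPolynomial σ ℂ)))
      inferInstance)
    (hu : u = TopologicalSpace.induced
      (fun z => (MvPolynomial.pointToPoint (k := ℂ) (d z) : PrimeSpectrum (MvPolynomial τ ℂ)))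
      inferInstance) (g : X → Y)
    (hg : ∀ f : MvPolynomial τ ℂ, ∃ h : MvPolynomial σ ℂ, ∀ z,
      MvPolynomial.aeval (c z) h = 0 ↔ MvPolynomial.aeval (d (g z)) f = 0) : Continuous g := by
  rw [continuous_iff_isClosed]
  intro S hS
  rw [← closure_subset_iff_isClosed]
  intro z hz
  rw [Set.mem_preimage, ← hS.closure_eq, mem_closure_induced_pointToPoint d hu]
  intro f hf
  obtain ⟨h, hh⟩ := hg f
  exact (hh z).1 ((mem_closure_induced_pointToPoint c ht _ _).1 hz h fun w hw =>
    (hh w).2 (hf _ hw))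

section points

variable {n : ℕ}

theorem RssPoint.mem_closure (S : Set (RssPoint n ℂ)) (z : RssPoint n ℂ) :
    z ∈ closure S ↔ ∀ f : CotangentRing n,
      (∀ w ∈ S, MvPolynomial.aeval w.coord f = 0) → MvPolynomial.aeval z.coord f = 0 :=
  mem_closure_induced_pointToPoint (fun z : RssPoint n ℂ => z.coord) rfl S z

theorem PlanePoint.mem_closure (S : Set (PlanePoint n)) (z : PlanePoint n) :
    z ∈ closure S ↔ ∀ f : PlaneRing n, (∀ w ∈ S, MvPolynomial.aeval (Sum.elim w.x w.y) f = 0) →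
      MvPolynomial.aeval (Sum.elim z.x z.y) f = 0 :=
  mem_closure_induced_pointToPoint (fun z : PlanePoint n => Sum.elim z.x z.y) rfl S z

theorem PlanePoint.isClosed_singleton (w : PlanePoint n) : IsClosed ({w} : Set (PlanePoint n)) := by
  rw [← closure_subset_iff_isClosed]
  intro z hz
  rw [PlanePoint.mem_closure] at hz
  have key : ∀ c, Sum.elim z.x z.y c = Sum.elim w.x w.y c := fun c => by
    have := hz (MvPolynomial.X c - MvPolynomial.C (Sum.elim w.x w.y c)) (by simp)
    simpa [sub_eq_zero] using this
  exact PlanePoint.ext (funext fun ι => key (.inl ι)) (funext fun ι => key (.inr ι))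

/-! ### Continuity of `P` on closed points -/

/-- The comorphism of `P` on polynomials. -/
def coordP (n : ℕ) : PlaneRing n →ₐ[ℂ] RssRing n :=
  MvPolynomial.aeval (Sum.elim (fun ι => (univPoint n).r ι ι) fun ι => (univPoint n).sPrime ι)

theorem evalAt_univPoint_r {A : Type*} [CommRing A] [Algebra ℂ A] (z : RssPoint n A)
    (ι γ : Fin n) : evalAt z ((univPoint n).r ι γ) = z.r ι γ := by
  conv_rhs => rw [← univPoint_map_evalAt z]
  rfl

theorem evalAt_univPoint_sPrime {A : Type*} [CommRing A] [Algebra ℂ A] (z : RssPoint n A)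
    (ι : Fin n) : evalAt z ((univPoint n).sPrime ι) = z.sPrime ι := by
  conv_rhs => rw [← univPoint_map_evalAt z]
  exact (RssPoint.sPrime_map _ _ _).symm

theorem evalAt_coordP (z : RssPoint n ℂ) (f : PlaneRing n) :
    evalAt z (coordP n f) = MvPolynomial.aeval (Sum.elim (mapP z).x (mapP z).y) f := by
  have : (evalAt z).comp (coordP n) = MvPolynomial.aeval (Sum.elim (mapP z).x (mapP z).y) := by
    refine MvPolynomial.algHom_ext fun c => ?_
    rcases c with ι | ι
    · simp [coordP, evalAt_univPoint_r, mapP]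
    · simp [coordP, evalAt_univPoint_sPrime, mapP]
  exact congrArg (fun g : PlaneRing n →ₐ[ℂ] ℂ => g f) this

/-- Multiplying by a power of the discriminant, which vanishes nowhere on the regular semisimple
locus, clears denominators without changing zeros. -/
theorem exists_polynomial_zero_iff (g : RssRing n) : ∃ h : CotangentRing n, ∀ z : RssPoint n ℂ,
    MvPolynomial.aeval z.coord h = 0 ↔ evalAt z g = 0 := by
  obtain ⟨a, rfl⟩ := Ideal.Quotient.mk_surjective g
  obtain ⟨k, h, hk⟩ := IsLocalization.Away.surj (discr n) a
  refine ⟨h, fun z => ?_⟩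
  change _ ↔ evalLoc z a = 0
  rw [← evalLoc_algebraMap, ← hk, map_mul]
  have hu : IsUnit (evalLoc z (algebraMap (CotangentRing n) (CotangentRssRing n) (discr n) ^ k)) :=
    ((IsLocalization.Away.algebraMap_isUnit (discr n)).pow k).map (evalLoc z)
  exact hu.mul_left_eq_zero

theorem continuous_mapP : Continuous (mapP (n := n)) := by
  refine continuous_of_pointToPoint (fun z : RssPoint n ℂ => z.coord)
    (fun w : PlanePoint n => Sum.elim w.x w.y) rfl rfl _ fun f => ?_
  obtain ⟨h, hh⟩ := exists_polynomial_zero_iff (coordP n f)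
  exact ⟨h, fun z => by rw [hh, evalAt_coordP]⟩

/-! ### Orbits and their degenerations -/

theorem mapP_smul (b : Borel n) (z : RssPoint n ℂ) : mapP (b • z) = mapP z := by
  rw [smul_eq_conj]
  have hg := Borel.toGL_upper ℂ b
  have hh := Borel.toGL_upper ℂ b⁻¹
  exact PlanePoint.ext (funext fun ι => z.conj_diag hg hh (toGL_inv_mul b) ι)
    (funext fun ι => z.conj_sPrime hg hh (toGL_inv_mul b) ι)

theorem conj_mem_orbit {g h : Matrix (Fin n) (Fin n) ℂ} (hg : g.IsUpperTriangular)
    (hh : h.IsUpperTriangular) (hhg : h * g = 1) (z : RssPoint n ℂ) :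
    z.conj g h hg hh hhg ∈ MulAction.orbit (Borel n) z := by
  let b : Borel n := ⟨⟨g, h, mul_eq_one_comm.1 hhg, hhg⟩, hg⟩
  refine ⟨b, ?_⟩
  have e : (Borel.toGL ℂ b).1 = g := by ext; rfl
  have e' : (Borel.toGL ℂ b⁻¹).1 = h := by ext; rfl
  change b • z = _
  rw [smul_eq_conj]
  congr

/-- Scaling `i` and `j` of a point of the diagonal slice stays inside the orbit. -/
theorem slice_scale_mem_orbit (z : RssPoint n ℂ) {d : Fin n → ℂ} (hz : z.r = Matrix.diagonal d)
    {τ : ℂ} (hτ : τ ≠ 0) (w : RssPoint n ℂ) (hw : w.r = Matrix.diagonal d)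
    (hs : ∀ ι, w.s ι ι = z.s ι ι) (hi : w.i = τ • z.i) (hj : w.j = τ • z.j) :
    w ∈ MulAction.orbit (Borel n) z := by
  classical
  -- The torus acts by `t` on `i` and by `t⁻¹` on `j`. As one of the two entries vanishes, `t` only
  -- has to scale the other: `τ⁻¹` if `i ι = 0`, `τ` if `j ι = 0`.
  have ht : ∀ ι, ∃ t : ℂ, t ≠ 0 ∧ t * z.i ι = τ * z.i ι ∧ z.j ι * t⁻¹ = τ * z.j ι := by
    intro ι
    rcases mul_eq_zero.1 (z.i_mul_j_of_diagonal hz ι) with h | h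
    · exact ⟨τ⁻¹, inv_ne_zero hτ, by simp [h], by rw [inv_inv, mul_comm]⟩
    · exact ⟨τ, hτ, rfl, by simp [h]⟩
  choose t ht0 hti htj using ht
  have htt : Matrix.diagonal (fun ι => (t ι)⁻¹) * Matrix.diagonal t =
      (1 : Matrix (Fin n) (Fin n) ℂ) := by
    rw [Matrix.diagonal_mul_diagonal, ← Matrix.diagonal_one]
    congr 1
    exact funext fun ι => inv_mul_cancel₀ (ht0 ι)
  have hd : ∀ v : Fin n → ℂ, (Matrix.diagonal v).IsUpperTriangular := fun v =>
    Matrix.blockTriangular_diagonal v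
  convert! conj_mem_orbit (hd t) (hd fun ι => (t ι)⁻¹) htt z using 1
  refine RssPoint.ext_of_diagonal hw ?_ (fun ι => ?_) ?_ ?_
  · change Matrix.diagonal t * z.r * Matrix.diagonal _ = _
    rw [hz, Matrix.diagonal_mul_diagonal, Matrix.diagonal_mul_diagonal]
    congr 1
    funext ι
    have := ht0 ι
    field_simp
  · change _ = lowerPart (Matrix.diagonal t * z.s * Matrix.diagonal _) ι ι
    rw [lowerPart_apply, if_pos le_rfl, Matrix.mul_diagonal, Matrix.diagonal_mul, hs]
    have := ht0 ι
    field_simp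
  · change _ = Matrix.diagonal t *ᵥ z.i
    funext ι
    rw [Matrix.mulVec_diagonal, hti, hi]
    rfl
  · change _ = z.j ᵥ* Matrix.diagonal _
    funext ι
    rw [Matrix.vecMul_diagonal, htj, hj]
    rfl

theorem PlanePoint.isUnit_sub (w : PlanePoint n) (ι γ : Fin n) (h : ι ≠ γ) :
    IsUnit (w.x ι - w.x γ) :=
  (sub_ne_zero.2 (w.x_injective.ne h)).isUnit

/-- The point with `r` and `s` diagonal and `i = j = 0`. -/
def diagonalPoint (w : PlanePoint n) : RssPoint n ℂ :=
  slice w.x w.y 0 0 w.isUnit_sub fun _ => by simp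

theorem mapP_diagonalPoint (w : PlanePoint n) : mapP (diagonalPoint w) = w :=
  PlanePoint.ext (funext fun ι => by simp [mapP, diagonalPoint, slice_r])
    (funext fun ι => slice_sPrime ..)

theorem toSlice_mem_orbit (z : RssPoint n ℂ) : z.toSlice ∈ MulAction.orbit (Borel n) z :=
  conj_mem_orbit _ _ _ z

theorem toSlice_s_self {A : Type*} [CommRing A] (z : RssPoint n A) (ι : Fin n) :
    z.toSlice.s ι ι = z.sPrime ι := by
  rw [← RssPoint.sPrime_of_diagonal _ z.toSlice_r]
  exact z.conj_sPrime _ _ _ ι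

/-- A function that is constant on an orbit takes the same value at the diagonal point in the
closure of the orbit. -/
theorem evalAt_diagonalPoint_of_orbit (z : RssPoint n ℂ) (f : RssRing n) (c : ℂ)
    (hf : ∀ w ∈ MulAction.orbit (Borel n) z, evalAt w f = c) :
    evalAt (diagonalPoint (mapP z)) f = c := by
  have hu := (mapP z).isUnit_sub
  have hxy := z.toSlice.i_mul_j_of_diagonal z.toSlice_r
  -- The degeneration as one point over `ℂ[X]`: specialising `X` to `τ` scales `i` and `j` of the
  -- slice point by `τ`.
  let q : RssPoint n (Polynomial ℂ) := slice (fun ι => .C ((mapP z).x ι))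
    (fun ι => .C ((mapP z).y ι)) (fun ι => .X * .C (z.toSlice.i ι))
    (fun ι => .X * .C (z.toSlice.j ι))
    (fun ι γ h => by simpa using (hu ι γ h).map (Polynomial.C : ℂ →+* Polynomial ℂ))
    (fun ι => by rw [mul_mul_mul_comm, ← Polynomial.C_mul, hxy]; simp)
  have hq : ∀ τ : ℂ, q.map (Polynomial.aeval (R := ℂ) τ : Polynomial ℂ →+* ℂ) =
      slice (mapP z).x (mapP z).y (τ • z.toSlice.i) (τ • z.toSlice.j) hu
        (fun ι => by simp [mul_mul_mul_comm, hxy]) := fun τ =>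
    slice_map _ _ _ _ _ (by simp) (by simp) (fun ι => by simp [mul_comm τ])
      (fun ι => by simp [mul_comm τ])
  -- For `τ ≠ 0` the specialisation stays in the orbit, so this polynomial has infinitely many
  -- roots; its value at `0` then gives the claim.
  have hF : evalAt q f - Polynomial.C c = 0 := by
    refine Polynomial.eq_zero_of_infinite_isRoot _
      (Set.Infinite.mono (s := {0}ᶜ) (fun τ hτ => ?_) (Set.finite_singleton (0 : ℂ)).infinite_compl)
    have hτ' : τ ≠ 0 := hτ
    have hmem : q.map (Polynomial.aeval (R := ℂ) τ : Polynomial ℂ →+* ℂ) ∈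
        MulAction.orbit (Borel n) z := by
      rw [hq, ← MulAction.orbit_eq_iff.2 (toSlice_mem_orbit z)]
      exact slice_scale_mem_orbit z.toSlice z.toSlice_r hτ' _ (slice_r ..)
        (fun ι => by rw [slice_s_self, toSlice_s_self]; rfl) rfl rfl
    have := hf _ hmem
    rw [evalAt_map_apply] at this
    change Polynomial.IsRoot _ _
    simpa [Polynomial.IsRoot.def, sub_eq_zero, Polynomial.coe_aeval_eq_eval] using this
  have h0 : q.map (Polynomial.aeval (R := ℂ) (0 : ℂ) : Polynomial ℂ →+* ℂ) = diagonalPoint (mapP z) :=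
    slice_map _ _ _ _ _ (by simp) (by simp) (by simp) (by simp)
  rw [← h0, evalAt_map_apply, sub_eq_zero.1 hF, Polynomial.aeval_C]
  rfl

theorem diagonalPoint_mem_closure (z : RssPoint n ℂ) :
    diagonalPoint (mapP z) ∈ closure (MulAction.orbit (Borel n) z) := by
  rw [RssPoint.mem_closure]
  intro f hf
  rw [← evalAt_toRssRing]
  exact evalAt_diagonalPoint_of_orbit z _ 0 fun w hw => by rw [evalAt_toRssRing, hf w hw]

/-- The fibre of `P` through `z` is closed and contains the orbit. -/
theorem mapP_eq_of_mem_closure {z w : RssPoint n ℂ}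
    (h : w ∈ closure (MulAction.orbit (Borel n) z)) : mapP w = mapP z := by
  have hc : IsClosed (mapP ⁻¹' {mapP z}) := (mapP z).isClosed_singleton.preimage continuous_mapP
  refine closure_minimal ?_ hc h
  rintro _ ⟨b, rfl⟩
  exact mapP_smul b z

theorem mapP_eq_iff_closuresMeet (z w : RssPoint n ℂ) : mapP z = mapP w ↔ closuresMeet z w := by
  constructor
  · intro h
    exact ⟨diagonalPoint (mapP z), diagonalPoint_mem_closure z, h ▸ diagonalPoint_mem_closure w⟩
  · rintro ⟨q, hz, hw⟩
    rw [← mapP_eq_of_mem_closure hz, mapP_eq_of_mem_closure hw]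

/-- The section is polynomial: with `i = j = 0` the entries of `s` below the diagonal vanish, so no
inverse of `d_ι - d_γ` occurs. -/
theorem continuous_diagonalPoint : Continuous (diagonalPoint (n := n)) := by
  refine continuous_of_pointToPoint (fun w : PlanePoint n => Sum.elim w.x w.y)
    (fun z : RssPoint n ℂ => z.coord) rfl rfl _ fun f => ?_
  let c : Coord n → PlaneRing n
    | .r ι γ _ => if ι = γ then MvPolynomial.X (.inl ι) else 0
    | .s ι γ _ => if γ = ι then MvPolynomial.X (.inr ι) else 0
    | .x _ => 0
    | .y _ => 0
  refine ⟨MvPolynomial.aeval c f, fun w => ?_⟩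
  have : (MvPolynomial.aeval (R := ℂ) (Sum.elim w.x w.y)).comp (MvPolynomial.aeval c) =
      MvPolynomial.aeval (R := ℂ) (diagonalPoint w).coord := by
    refine MvPolynomial.algHom_ext fun v => ?_
    rcases v with ⟨ι, γ, h⟩ | ⟨ι, γ, h⟩ | k | k
    · by_cases e : ι = γ <;> simp [c, diagonalPoint, slice, CotangentPoint.coord, e]
    · by_cases e : γ = ι <;> simp [c, diagonalPoint, slice, CotangentPoint.coord, e]
    · simp [c, diagonalPoint, slice, CotangentPoint.coord]
    · simp [c, diagonalPoint, slice, CotangentPoint.coord]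
  exact iff_of_eq (congrArg (fun g : CotangentRing n →ₐ[ℂ] ℂ => g f = 0) this)

/-- `P` descends to a homeomorphism from the space of orbit closures to `ℂ^{2n} \ Δ_n`. -/
def orbitClosureHomeomorph (n : ℕ) : OrbitClosureSpace n ≃ₜ PlanePoint n where
  toFun := Quot.lift mapP fun z w h => (mapP_eq_iff_closuresMeet z w).2 h
  invFun w := Quot.mk _ (diagonalPoint w)
  left_inv := by
    rintro ⟨z⟩
    exact Quot.sound ((mapP_eq_iff_closuresMeet _ _).1 (mapP_diagonalPoint _))
  right_inv w := mapP_diagonalPoint w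
  continuous_toFun := continuous_quot_lift _ continuous_mapP
  continuous_invFun := continuous_quot_mk.comp continuous_diagonalPoint

end points

/-! ### The ring of invariants -/

section invariants

variable {n : ℕ}

theorem coordP_mem_invariants (f : PlaneRing n) : coordP n f ∈ invariants n := by
  have : (coordP n).range ≤ invariants n := by
    rw [coordP, ← Algebra.adjoin_range_eq_range_aeval, Algebra.adjoin_le_iff]
    rintro _ ⟨ι | ι, rfl⟩
    · refine mem_invariants.2 fun b => ?_
      have hg := Borel.toGL_upper (RssRing n) b
      have hh := Borel.toGL_upper (RssRing n) b⁻¹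
      exact (evalAt_univPoint_r _ _ _).trans
        ((univPoint n).conj_diag hg hh (toGL_inv_mul b) ι)
    · refine mem_invariants.2 fun b => ?_
      have hg := Borel.toGL_upper (RssRing n) b
      have hh := Borel.toGL_upper (RssRing n) b⁻¹
      exact (evalAt_univPoint_sPrime _ _).trans
        ((univPoint n).conj_sPrime hg hh (toGL_inv_mul b) ι)
  exact this ⟨f, rfl⟩

/-- Translations are ring maps, so an inverse of an invariant is again invariant. -/
theorem isUnit_coe_invariants {f : invariants n} (hf : IsUnit (f : RssRing n)) : IsUnit f := by
  obtain ⟨g, hg⟩ := hf.exists_right_inv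
  refine IsUnit.of_mul_eq_one ⟨g, mem_invariants.2 fun b => ?_⟩ (Subtype.ext hg)
  refine hf.mul_left_cancel ?_
  have h1 : translate b (f : RssRing n) = f := mem_invariants.1 f.2 b
  rw [hg]
  nth_rw 1 [← h1]
  rw [← map_mul, hg, map_one]

theorem isUnit_coordP_planeDiscr (n : ℕ) : IsUnit (coordP n (planeDiscr n)) := by
  have e := map_prodDiff (coordP n : PlaneRing n →+* RssRing n)
    fun ι => MvPolynomial.X (Sum.inl ι)
  refine e ▸ isUnit_prodDiff.2 fun ι γ h => ?_
  simpa [coordP] using (univPoint n).isUnit_sub h.ne'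

/-- The comorphism of `P` on polynomials, with values in the invariants. -/
def coordInvariants (n : ℕ) : PlaneRing n →ₐ[ℂ] invariants n :=
  (coordP n).codRestrict (invariants n) coordP_mem_invariants

/-- The comorphism of `P`. -/
def comorphism (n : ℕ) : PlaneRssRing n →ₐ[ℂ] invariants n :=
  IsLocalization.liftAlgHom (M := Submonoid.powers (planeDiscr n)) (S := PlaneRssRing n)
    (f := coordInvariants n) (by
      rintro ⟨_, k, rfl⟩
      simp only [map_pow]
      exact (isUnit_coe_invariants (isUnit_coordP_planeDiscr n)).pow k)

theorem comorphism_algebraMap (f : PlaneRing n) :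
    comorphism n (algebraMap (PlaneRing n) (PlaneRssRing n) f) = coordInvariants n f :=
  IsLocalization.lift_eq _ _

/-- The structure map `ℂ[ℂ^{2n}] → ℂ[ℂ^{2n} \ Δ_n]`. -/
def toPlaneRssRing (n : ℕ) : PlaneRing n →ₐ[ℂ] PlaneRssRing n :=
  IsScalarTower.toAlgHom ℂ (PlaneRing n) (PlaneRssRing n)

theorem isUnit_sub_planeRssRing (n : ℕ) (ι γ : Fin n) (h : ι ≠ γ) :
    IsUnit (toPlaneRssRing n (MvPolynomial.X (Sum.inl ι)) -
      toPlaneRssRing n (MvPolynomial.X (Sum.inl γ))) := by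
  refine isUnit_sub_of_isUnit_prodDiff
    (d := fun ι => toPlaneRssRing n (MvPolynomial.X (Sum.inl ι))) ?_ ι γ h
  have e := map_prodDiff (toPlaneRssRing n : PlaneRing n →+* PlaneRssRing n)
    fun ι => MvPolynomial.X (Sum.inl ι)
  exact e ▸ IsLocalization.Away.algebraMap_isUnit (S := PlaneRssRing n) (planeDiscr n)

/-- The tautological point with `r` and `s` diagonal and `i = j = 0`. -/
def genericDiagonalPoint (n : ℕ) : RssPoint n (PlaneRssRing n) :=
  slice (fun ι => toPlaneRssRing n (MvPolynomial.X (Sum.inl ι)))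
    (fun ι => toPlaneRssRing n (MvPolynomial.X (Sum.inr ι))) (fun _ => 0) (fun _ => 0)
    (isUnit_sub_planeRssRing n) fun _ => mul_zero _

/-- Restriction of invariant functions to the diagonal points. -/
def restrictDiagonal (n : ℕ) : invariants n →ₐ[ℂ] PlaneRssRing n :=
  (evalAt (genericDiagonalPoint n)).comp (invariants n).val

/-- On diagonal points `P` reads off the diagonals of `r` and `s`, which are the coordinates
themselves. -/
theorem restrictDiagonal_coordInvariants (f : PlaneRing n) :
    restrictDiagonal n (coordInvariants n f) = toPlaneRssRing n f := by
  have h : (restrictDiagonal n).comp (coordInvariants n) = toPlaneRssRing n := by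
    refine MvPolynomial.algHom_ext fun c => ?_
    change evalAt (genericDiagonalPoint n) (coordP n (MvPolynomial.X c)) = _
    rw [coordP, MvPolynomial.aeval_X]
    rcases c with ι | ι
    · refine (evalAt_univPoint_r _ ι ι).trans ?_
      rw [genericDiagonalPoint, slice_r, Matrix.diagonal_apply_eq]
    · refine (evalAt_univPoint_sPrime _ ι).trans ?_
      rw [genericDiagonalPoint, slice_sPrime]
  exact congrArg (fun g : PlaneRing n →ₐ[ℂ] PlaneRssRing n => g f) h

theorem restrictDiagonal_comp_comorphism (n : ℕ) :
    (restrictDiagonal n).comp (comorphism n) = AlgHom.id ℂ (PlaneRssRing n) := by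
  refine AlgHom.coe_ringHom_injective
    (IsLocalization.ringHom_ext (Submonoid.powers (planeDiscr n)) (RingHom.ext fun f => ?_))
  change restrictDiagonal n (comorphism n (algebraMap (PlaneRing n) (PlaneRssRing n) f)) = _
  rw [comorphism_algebraMap]
  exact restrictDiagonal_coordInvariants f

/-- The value at `z` of the comorphism applied to a function on `ℂ^{2n} \ Δ_n`. -/
def evalComorphism (z : RssPoint n ℂ) : PlaneRssRing n →ₐ[ℂ] ℂ :=
  ((evalAt z).comp (invariants n).val).comp (comorphism n)

theorem evalComorphism_toPlaneRssRing (z : RssPoint n ℂ) (g : PlaneRing n) :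
    evalComorphism z (toPlaneRssRing n g) =
      MvPolynomial.aeval (Sum.elim (mapP z).x (mapP z).y) g := by
  rw [← evalAt_coordP]
  change evalAt z (comorphism n (algebraMap (PlaneRing n) (PlaneRssRing n) g) : invariants n) = _
  rw [comorphism_algebraMap]
  rfl

theorem genericDiagonalPoint_map (z : RssPoint n ℂ) :
    (genericDiagonalPoint n).map (evalComorphism z : PlaneRssRing n →+* ℂ) =
      diagonalPoint (mapP z) :=
  slice_map _ _ _ _ _
    (fun _ => (evalComorphism_toPlaneRssRing z _).trans (MvPolynomial.aeval_X _ _))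
    (fun _ => (evalComorphism_toPlaneRssRing z _).trans (MvPolynomial.aeval_X _ _))
    (fun _ => map_zero _) (fun _ => map_zero _)

/-- By reducedness it suffices to compare values at each `z`. The left side takes the value of `f`
at `diagonalPoint (mapP z)`, which is its constant value on the orbit of `z`. -/
theorem comorphism_restrictDiagonal (f : invariants n) :
    comorphism n (restrictDiagonal n f) = f := by
  refine Subtype.ext (eq_of_evalAt_eq fun z => ?_)
  change evalComorphism z (evalAt (genericDiagonalPoint n) (f : RssRing n)) = _
  rw [← evalAt_map_apply, genericDiagonalPoint_map]
  refine evalAt_diagonalPoint_of_orbit z f _ ?_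
  rintro _ ⟨b, rfl⟩
  change evalAt (b • z) _ = _
  rw [← evalAt_translate, mem_invariants.1 f.2 b]

/-- The comorphism of `P` is an isomorphism onto the ring of invariants. -/
def comorphismEquiv (n : ℕ) : PlaneRssRing n ≃ₐ[ℂ] invariants n :=
  AlgEquiv.ofAlgHom (comorphism n) (restrictDiagonal n)
    (AlgHom.ext comorphism_restrictDiagonal) (restrictDiagonal_comp_comorphism n)

end invariants

/-! ### The isomorphism of varieties -/

section schemes

variable (n : ℕ)

/-- The morphism `μ⁻¹(0)^{rss} // B → ℂ^{2n}` induced by `P`. -/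
def quotientToPlane : affineQuotient n ⟶ plane n :=
  Spec.map (CommRingCat.ofHom (coordInvariants n).toRingHom)

theorem quotientMap_quotientToPlane : quotientMap n ≫ quotientToPlane n = morphismP n :=
  (Spec.map_comp _ _).symm

theorem isLocalization_coordInvariants :
    @IsLocalization.Away _ _ (planeDiscr n) (invariants n) _
      (coordInvariants n).toRingHom.toAlgebra := by
  let _ : Algebra (PlaneRing n) (invariants n) := (coordInvariants n).toRingHom.toAlgebra
  let e : PlaneRssRing n ≃ₐ[PlaneRing n] invariants n :=
    AlgEquiv.ofRingEquiv (f := (comorphismEquiv n).toRingEquiv) comorphism_algebraMap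
  exact IsLocalization.isLocalization_of_algEquiv (Submonoid.powers (planeDiscr n)) e

instance : IsOpenImmersion (quotientToPlane n) := by
  let _ : Algebra (PlaneRing n) (invariants n) := (coordInvariants n).toRingHom.toAlgebra
  have := isLocalization_coordInvariants n
  exact IsOpenImmersion.of_isLocalization (planeDiscr n)

theorem diagonalLocus_compl :
    (diagonalLocus n)ᶜ = (PrimeSpectrum.basicOpen (planeDiscr n) : Set _) := by
  ext p
  simp only [diagonalLocus, Set.mem_compl_iff, Set.mem_iUnion, PrimeSpectrum.mem_zeroLocus,
    Set.singleton_subset_iff, SetLike.mem_coe, PrimeSpectrum.mem_basicOpen, not_iff_not]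
  rw [planeDiscr, prodDiff, p.2.prod_mem_iff]
  constructor
  · rintro ⟨⟨⟨ι, γ⟩, h⟩, hm⟩
    rcases lt_or_gt_of_ne h with hlt | hlt
    · refine ⟨(ι, γ), by simpa using hlt, ?_⟩
      -- The discriminant has one factor per unordered pair, with the larger index first, so the
      -- other order costs a sign.
      rw [← neg_sub]
      exact p.asIdeal.neg_mem hm
    · exact ⟨(γ, ι), by simpa using hlt, hm⟩
  · rintro ⟨⟨ι, γ⟩, h, hm⟩
    have h' : ι < γ := by simpa using h
    exact ⟨⟨(γ, ι), h'.ne'⟩, hm⟩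

theorem range_quotientToPlane :
    Set.range (quotientToPlane n) = Set.range (planeMinusDelta n).ι := by
  rw [Scheme.Opens.range_ι]
  change _ = (diagonalLocus n)ᶜ
  rw [diagonalLocus_compl]
  let _ : Algebra (PlaneRing n) (invariants n) := (coordInvariants n).toRingHom.toAlgebra
  have := isLocalization_coordInvariants n
  exact PrimeSpectrum.localization_away_comap_range (invariants n) (planeDiscr n)

/-- The isomorphism `μ⁻¹(0)^{rss} // B ≅ ℂ^{2n} \ Δ_n` induced by `P`. -/
def quotientIso : affineQuotient n ≅ (planeMinusDelta n).toScheme :=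
  IsOpenImmersion.isoOfRangeEq (quotientToPlane n) (planeMinusDelta n).ι
    (range_quotientToPlane n)

theorem quotientIso_hom_ι : (quotientIso n).hom ≫ (planeMinusDelta n).ι = quotientToPlane n :=
  IsOpenImmersion.isoOfRangeEq_hom_fac _ _ _

/-- Both primes consist of the polynomials that vanish at `P(z)`. -/
theorem morphismP_toSpec (z : RssPoint n ℂ) : morphismP n z.toSpec = (mapP z).toPlane := by
  refine PrimeSpectrum.ext (Ideal.ext fun f => ?_)
  change evalAt z (coordP n f) ∈ (⊥ : Ideal ℂ) ↔
    f ∈ MvPolynomial.vanishingIdeal ℂ {Sum.elim (mapP z).x (mapP z).y}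
  rw [evalAt_coordP, MvPolynomial.mem_vanishingIdeal_singleton_iff, Ideal.mem_bot]

end schemes

end BorelMoment

end

open BorelMoment in
theorem mainTheorem7 (n : ℕ) :
    -- `P` separates orbit closures and descends to a homeomorphism `p`
    (∀ z w : RssPoint n ℂ, mapP z = mapP w ↔ closuresMeet z w) ∧
    (∃ p : OrbitClosureSpace n ≃ₜ PlanePoint n,
      ∀ z : RssPoint n ℂ, p (Quot.mk _ z) = mapP z) ∧
    -- the isomorphism of coordinate rings
    (∃ e : PlaneRssRing n ≃ₐ[ℂ] invariants n,
      (∀ ι, (e (algebraMap (PlaneRing n) _ (MvPolynomial.X (Sum.inl ι))) : RssRing n) =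
        (univPoint n).r ι ι) ∧
      (∀ ι, (e (algebraMap (PlaneRing n) _ (MvPolynomial.X (Sum.inr ι))) : RssRing n) =
        (univPoint n).sPrime ι)) ∧
    -- the isomorphism of varieties over `ℂ` induced by `P`
    (∃ φ : affineQuotient n ≅ (planeMinusDelta n).toScheme,
      quotientMap n ≫ φ.hom ≫ (planeMinusDelta n).ι = morphismP n ∧
      φ.hom ≫ (planeMinusDelta n).ι ≫
          Spec.map (CommRingCat.ofHom (algebraMap ℂ (PlaneRing n))) =
        Spec.map (CommRingCat.ofHom (algebraMap ℂ (invariants n))) ∧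
      ∀ z : RssPoint n ℂ,
        (quotientMap n ≫ φ.hom ≫ (planeMinusDelta n).ι) z.toSpec = (mapP z).toPlane) := by
  refine ⟨mapP_eq_iff_closuresMeet, ⟨orbitClosureHomeomorph n, fun _ => rfl⟩,
    ⟨comorphismEquiv n, fun ι => ?_, fun ι => ?_⟩, ⟨quotientIso n, ?_, ?_, fun z => ?_⟩⟩
  · change ((comorphism n (algebraMap (PlaneRing n) (PlaneRssRing n) _) : invariants n) :
      RssRing n) = _
    rw [comorphism_algebraMap]
    exact MvPolynomial.aeval_X _ _
  · change ((comorphism n (algebraMap (PlaneRing n) (PlaneRssRing n) _) : invariants n) :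
      RssRing n) = _
    rw [comorphism_algebraMap]
    exact MvPolynomial.aeval_X _ _
  · rw [quotientIso_hom_ι, quotientMap_quotientToPlane]
  · rw [← Category.assoc, quotientIso_hom_ι]
    refine (Spec.map_comp _ _).symm.trans (congrArg Spec.map ?_)
    ext1
    exact (coordInvariants n).comp_algebraMap
  · rw [quotientIso_hom_ι, quotientMap_quotientToPlane, morphismP_toSpec]
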